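/- All locally compact spaces are assumed Hausdorff. A locally compact groupoid is a groupoid $G$, with unit set $G^{(0)}\subseteq G$, range and source maps $r,s:G\to G^{(0)}$, equipped with a locally compact topology such that the structure maps are continuous and $r$ is open; it is étale if $r$ is a local homeomorphism. Put $G^x=r^{-1}(x)$. $G$ is amenable if there is a net $(m_i)$ of families $m_i=(m_i^x)_{x\in G^{(0)}}$ of (Radon) probability measures $m_i^x$ on $G^x$ such that $x\mapsto\int f\,dm_i^x$ is continuous for every $f\in C_c(G)$ and every $i$, and $\lim_i\|\gamma m_i^{s(\gamma)}-m_i^{r(\gamma)}\|_1=0$ uniformly on compact subsets of $G$, where $\gamma m$ is the image of $m$ under $\gamma_1\mapsto\gamma\gamma_1$. A $G$-space is a locally compact space $Y$ with a continuous surjection $p:Y\to G^{(0)}$ (not required to be open) and a continuous action $(\gamma,y)\mapsto\gamma y\in Y$, defined when $s(\gamma)=p(y)$, with $p(\gamma y)=r(\gamma)$, $p(y)y=y$ and $(\gamma_2\gamma_1)y=\gamma_2(\gamma_1y)$. It is amenable if the semi-direct product groupoid $Y\rtimes G=\{(y,\gamma)\in Y\times G: p(y)=r(\gamma)\}$, with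 unit space $\{(y,p(y)):y\in Y\}\cong Y$, range $(y,\gamma)\mapsto y$, source $(y,\gamma)\mapsto\gamma^{-1}y$, product $(y,\gamma)(\gamma^{-1}y,\gamma_1)=(y,\gamma\gamma_1)$ and inverse $(y,\gamma)^{-1}=(\gamma^{-1}y,\gamma^{-1})$, is amenable. $G$ is strongly amenable at infinity if there is an amenable $G$-space $(Y,p)$ such that $p$ is proper and has a continuous section. Let $G*_rG=\{(\gamma,\gamma_1)\in G\times G: r(\gamma)=r(\gamma_1)\}$, with the topology induced by $G\times G$. A function $k:G*_rG\to\mathbb C$ is a positive definite kernel if $\sum_{i,j=1}^n\overline{\alpha_i}\alpha_jk(\gamma_i,\gamma_j)\ge 0$ for all $x\in G^{(0)}$, $n\in\mathbb N$, $\gamma_1,\dots,\gamma_n\in G^x$ and $\alpha_1,\dots,\alpha_n\in\mathbb C$. A tube is a subset of $G*_rG$ whose image under $(\gamma,\gamma_1)\mapsto\gamma^{-1}\gamma_1$ is relatively compact in $G$. **Theorem.** Let $G$ be an étale groupoid. The following conditions are equivalent: (i) $G$ is strongly amenable at infinity; (ii) there is a net $(k_i)_{i\in I}$ of bounded, continuous,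 positive definite kernels on $G*_rG$, each supported in a tube, such that for every tube $T$, $\lim_ik_i=1$ uniformly on $T$. -/

import Mathlib

open MeasureTheory Filter Topology
open scoped ComplexOrder ComplexConjugate

universe u v

namespace TopGpd

/-- A groupoid, given by its set `G` of arrows, its subset of units, the range and source maps,
the composition of composable pairs and the inversion. -/
class GroupoidStr (G : Type u) where
  /-- the set `G⁽⁰⁾` of units -/
  units : Set G
  /-- range -/
  r : G → units
  /-- source -/
  s : G → units
  /-- composition, for `(a, b) ∈ G⁽²⁾` -/
  mul : (a b : G) → s a = r b → G
  /-- inverse -/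
  inv : G → G
  r_unit : ∀ x : units, r x = x
  s_unit : ∀ x : units, s x = x
  r_mul : ∀ a b h, r (mul a b h) = r a
  s_mul : ∀ a b h, s (mul a b h) = s b
  mul_assoc : ∀ (a b c : G) (hab : s a = r b) (hbc : s b = r c),
    mul (mul a b hab) c ((s_mul a b hab).trans hbc) =
      mul a (mul b c hbc) (hab.trans (r_mul b c hbc).symm)
  unit_mul : ∀ a, mul (r a) a (s_unit (r a)) = a
  mul_unit : ∀ a, mul a (s a) (r_unit (s a)).symm = a
  r_inv : ∀ a, r (inv a) = s a
  s_inv : ∀ a, s (inv a) = r a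
  mul_inv : ∀ a, mul a (inv a) (r_inv a).symm = r a
  inv_mul : ∀ a, mul (inv a) a (s_inv a) = s a

open GroupoidStr

theorem mul_congr {G : Type u} [GroupoidStr G] {a a' b b' : G} (ha : a = a') (hb : b = b')
    (h : s a = r b) (h' : s a' = r b') : mul a b h = mul a' b' h' := by
  subst ha hb; rfl

theorem eq_inv_of_mul_eq {G : Type u} [GroupoidStr G] (a c : G) (h : s c = r a)
    (hc : mul c a h = s a) : c = inv a := by
  calc c = mul c (s c : G) (r_unit _).symm := (mul_unit c).symm
    _ = mul c (mul a (inv a) (r_inv a).symm) (h.trans (r_mul _ _ _).symm) :=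
        mul_congr rfl (by rw [GroupoidStr.mul_inv, h]) _ _
    _ = mul (mul c a h) (inv a) ((s_mul _ _ _).trans (r_inv a).symm) :=
        (mul_assoc _ _ _ _ _).symm
    _ = mul (r (inv a) : G) (inv a) (s_unit _) := mul_congr (by rw [hc, r_inv]) rfl _ _
    _ = inv a := unit_mul _

theorem inv_unit {G : Type u} [GroupoidStr G] (x : units (G := G)) : inv (x : G) = x := by
  have h : s (x : G) = r (x : G) := (s_unit x).trans (r_unit x).symm
  refine (eq_inv_of_mul_eq (x : G) x h ?_).symm
  calc mul (x : G) x h = mul ((r (x : G) : G)) x (s_unit _) :=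
        mul_congr (by rw [r_unit]) rfl _ _
    _ = (x : G) := unit_mul _
    _ = s (x : G) := by rw [s_unit]

theorem inv_mul_rev {G : Type u} [GroupoidStr G] (a b : G) (h : s a = r b) :
    inv (mul a b h) =
      mul (inv b) (inv a) ((s_inv b).trans (h.symm.trans (r_inv a).symm)) := by
  have h1 : s (inv b) = r (inv a) := (s_inv b).trans (h.symm.trans (r_inv a).symm)
  have h2 : s (inv a) = r (mul a b h) := (s_inv a).trans (r_mul _ _ _).symm
  refine (eq_inv_of_mul_eq _ _ ((s_mul _ _ _).trans h2) ?_).symm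
  rw [mul_assoc _ _ _ h1 h2]
  have h3 : mul (inv a) (mul a b h) h2 = b := by
    rw [← mul_assoc _ _ _ (s_inv a) h]
    calc _ = mul (r b : G) b (s_unit _) := mul_congr (by rw [inv_mul, h]) rfl _ _
      _ = b := unit_mul b
  calc _ = mul (inv b) b (s_inv b) := mul_congr rfl h3 _ _
    _ = _ := by rw [inv_mul, s_mul]

/-- A locally compact groupoid: a groupoid with a locally compact Hausdorff topology for which the
structure maps are continuous and the range map is open; the units and the composable pairs carry
the induced topologies. -/
class IsLocallyCompactGroupoid (G : Type u) [TopologicalSpace G] [GroupoidStr G] : Prop where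
  locallyCompactSpace : LocallyCompactSpace G
  t2Space : T2Space G
  continuous_r : Continuous (r : G → units (G := G))
  continuous_s : Continuous (s : G → units (G := G))
  continuous_mul : Continuous fun q : {q : G × G // s q.1 = r q.2} => mul q.1.1 q.1.2 q.2
  continuous_inv : Continuous (inv : G → G)
  isOpenMap_r : IsOpenMap (r : G → units (G := G))

/-- An étale groupoid: a locally compact groupoid whose range map is a local homeomorphism. -/
class IsEtaleGroupoid (G : Type u) [TopologicalSpace G] [GroupoidStr G] : Prop
    extends IsLocallyCompactGroupoid G where
  isLocalHomeomorph_r : IsLocalHomeomorph (r : G → units (G := G))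

/-- The fibre `Gˣ = r⁻¹(x)`. -/
abbrev RFiber (G : Type u) [GroupoidStr G] (x : units (G := G)) : Type u := {a : G // r a = x}

/-- Left translation `Gˢ⁽ᵃ⁾ → Gʳ⁽ᵃ⁾`, `b ↦ a b`. -/
def leftTranslation {G : Type u} [GroupoidStr G] (a : G) (b : RFiber G (s a)) : RFiber G (r a) :=
  ⟨mul a b.1 b.2.symm, r_mul _ _ _⟩

theorem continuous_leftTranslation {G : Type u} [TopologicalSpace G] [GroupoidStr G]
    [IsLocallyCompactGroupoid G] (a : G) : Continuous (leftTranslation a) :=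
  ((IsLocallyCompactGroupoid.continuous_mul (G := G)).comp
    (f := fun b : RFiber G (s a) => ⟨(a, b.1), b.2.symm⟩) (by fun_prop)).subtype_mk _

/-- The translate `a μ` of a probability measure `μ` on `Gˢ⁽ᵃ⁾`: `∫ f d(a μ) = ∫ f(a b) dμ(b)`. -/
noncomputable def translate {G : Type u} [TopologicalSpace G] [GroupoidStr G]
    [IsLocallyCompactGroupoid G] [MeasurableSpace G] [BorelSpace G]
    (a : G) (μ : ProbabilityMeasure (RFiber G (s a))) : ProbabilityMeasure (RFiber G (r a)) :=
  μ.map (continuous_leftTranslation a).measurable.aemeasurable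

/-- The total variation norm `‖μ - ν‖₁`. -/
noncomputable def normDiff {α : Type u} [MeasurableSpace α] (μ ν : ProbabilityMeasure α) : ℝ :=
  (((μ : Measure α).toSignedMeasure - (ν : Measure α).toSignedMeasure).totalVariation
    Set.univ).toReal

/-- Amenability: there is a net of continuous families of (Radon) probability measures on the
fibres `Gˣ` which is approximately invariant, uniformly on compact subsets. -/
def IsAmenable (G : Type u) [TopologicalSpace G] [GroupoidStr G] [IsLocallyCompactGroupoid G]
    [MeasurableSpace G] [BorelSpace G] : Prop :=
  ∃ (I : Type u) (_ : Preorder I) (_ : IsDirectedOrder I) (_ : Nonempty I)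
    (m : I → (x : units (G := G)) → ProbabilityMeasure (RFiber G x)),
    (∀ i x, (m i x : Measure (RFiber G x)).Regular) ∧
    (∀ i, ∀ f : G → ℂ, Continuous f → HasCompactSupport f →
      Continuous fun x : units (G := G) =>
        ∫ a : RFiber G x, f a.1 ∂(m i x : Measure (RFiber G x))) ∧
    ∀ K : Set G, IsCompact K →
      TendstoUniformlyOn (fun i (a : G) => normDiff (translate a (m i (s a))) (m i (r a)))
        (fun _ => 0) atTop K

/-- A left `G`-space structure on `Y`: a fibre space `(Y, p)` over `G⁽⁰⁾` (that is, `Y` is locally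
compact Hausdorff and `p` is a continuous surjection; it need not be open), with a continuous
action of `G`. -/
structure GSpace (G : Type u) [TopologicalSpace G] [GroupoidStr G]
    (Y : Type v) [TopologicalSpace Y] where
  locallyCompactSpace : LocallyCompactSpace Y
  t2Space : T2Space Y
  /-- the momentum map -/
  p : Y → units (G := G)
  continuous_p : Continuous p
  surjective_p : Function.Surjective p
  /-- the action, `(a, y) ↦ a y` when `s a = p y` -/
  act : (a : G) → (y : Y) → s a = p y → Y
  continuous_act : Continuous fun q : {q : G × Y // s q.1 = p q.2} => act q.1.1 q.1.2 q.2
  p_act : ∀ a y h, p (act a y h) = r a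
  unit_act : ∀ y, act (p y) y (s_unit (p y)) = y
  mul_act : ∀ (a b : G) (y : Y) (hab : s a = r b) (hb : s b = p y),
    act (mul a b hab) y ((s_mul a b hab).trans hb) =
      act a (act b y hb) (hab.trans (p_act b y hb).symm)

/-- The set underlying the semi-direct product groupoid `Y ⋊ G`: pairs `(y, a)` with
`p y = r a`. -/
def SemidirectProduct {G : Type u} [TopologicalSpace G] [GroupoidStr G]
    {Y : Type v} [TopologicalSpace Y] (A : GSpace G Y) : Type (max u v) :=
  {q : Y × G // A.p q.1 = r q.2}

namespace SemidirectProduct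

variable {G : Type u} [TopologicalSpace G] [GroupoidStr G] {Y : Type v} [TopologicalSpace Y]
  {A : GSpace G Y}

instance : TopologicalSpace (SemidirectProduct A) :=
  inferInstanceAs (TopologicalSpace {q : Y × G // A.p q.1 = r q.2})

instance : MeasurableSpace (SemidirectProduct A) := borel _

instance : BorelSpace (SemidirectProduct A) := ⟨rfl⟩

/-- `(y, p y)`, the unit of `Y ⋊ G` given by `y`. -/
def unit (A : GSpace G Y) (y : Y) : SemidirectProduct A := ⟨(y, A.p y), (r_unit _).symm⟩

/-- `a⁻¹ y` for `(y, a) ∈ Y ⋊ G`. -/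
def invAct (q : SemidirectProduct A) : Y :=
  A.act (inv q.1.2) q.1.1 ((s_inv _).trans q.2.symm)

theorem _root_.TopGpd.GSpace.act_congr (A : GSpace G Y) {a a' : G} {y y' : Y} (ha : a = a')
    (hy : y = y') (h : s a = A.p y) (h' : s a' = A.p y') : A.act a y h = A.act a' y' h' := by
  subst ha hy; rfl

theorem unit_injective (A : GSpace G Y) : Function.Injective (unit A) := fun _ _ h =>
  congrArg (fun q => q.1.1) h

theorem ext_iff' {q q' : SemidirectProduct A} (h1 : q.1.1 = q'.1.1) (h2 : q.1.2 = q'.1.2) :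
    q = q' := Subtype.ext (Prod.ext h1 h2)

theorem p_invAct (q : SemidirectProduct A) : A.p (invAct q) = s q.1.2 :=
  (A.p_act _ _ _).trans (r_inv _)

theorem invAct_unit (y : Y) : invAct (unit A y) = y :=
  (A.act_congr (inv_unit (A.p y)) rfl _ (s_unit _)).trans (A.unit_act y)

/-- The product of `(y, a)` and `(a⁻¹ y, b)` is `(y, a b)`. -/
def comp (q q' : SemidirectProduct A) (h : invAct q = q'.1.1) : SemidirectProduct A :=
  ⟨(q.1.1, mul q.1.2 q'.1.2 ((p_invAct q).symm.trans ((congrArg A.p h).trans q'.2))),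
    q.2.trans (r_mul _ _ _).symm⟩

/-- The inverse of `(y, a)` is `(a⁻¹ y, a⁻¹)`. -/
def inverse (q : SemidirectProduct A) : SemidirectProduct A :=
  ⟨(invAct q, inv q.1.2), (p_invAct q).trans (r_inv _).symm⟩

theorem invAct_comp (q q' : SemidirectProduct A) (h : invAct q = q'.1.1) :
    invAct (comp q q' h) = invAct q' := by
  have hs : s q.1.2 = r q'.1.2 := (p_invAct q).symm.trans ((congrArg A.p h).trans q'.2)
  have h1 : s (inv q'.1.2) = r (inv q.1.2) := (s_inv _).trans (hs.symm.trans (r_inv _).symm)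
  have h2 : s (inv q.1.2) = A.p q.1.1 := (s_inv _).trans q.2.symm
  calc invAct (comp q q' h)
      = A.act (mul (inv q'.1.2) (inv q.1.2) h1) q.1.1 ((s_mul _ _ _).trans h2) :=
        A.act_congr (inv_mul_rev _ _ _) rfl _ _
    _ = A.act (inv q'.1.2) (A.act (inv q.1.2) q.1.1 h2) _ := A.mul_act _ _ _ _ _
    _ = invAct q' := A.act_congr rfl h _ _

theorem invAct_inverse (q : SemidirectProduct A) : invAct (inverse q) = q.1.1 := by
  have h2 : s (inv q.1.2) = A.p q.1.1 := (s_inv _).trans q.2.symm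
  calc invAct (inverse q)
      = A.act (mul (inv (inv q.1.2)) (inv q.1.2) (s_inv _)) q.1.1 ((s_mul _ _ _).trans h2) :=
        (A.mul_act _ _ _ _ _).symm
    _ = A.act (A.p q.1.1) q.1.1 (s_unit _) := A.act_congr (by rw [inv_mul, h2]) rfl _ _
    _ = q.1.1 := A.unit_act _

theorem invAct_eq {q q' : SemidirectProduct A}
    (h : (⟨unit A (invAct q), _, rfl⟩ : Set.range (unit A)) = ⟨unit A q'.1.1, _, rfl⟩) :
    invAct q = q'.1.1 := unit_injective A (congrArg Subtype.val h)

/-- The groupoid structure of `Y ⋊ G`: the units are the `(y, p y)`, the range of `(y, a)` is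
`(y, p y)`, its source is `(a⁻¹ y, s a)`, the product is `(y, a)(a⁻¹ y, b) = (y, a b)` and the
inverse is `(y, a)⁻¹ = (a⁻¹ y, a⁻¹)`. -/
instance : GroupoidStr (SemidirectProduct A) where
  units := Set.range (unit A)
  r q := ⟨unit A q.1.1, _, rfl⟩
  s q := ⟨unit A (invAct q), _, rfl⟩
  mul q q' h := comp q q' (invAct_eq h)
  inv q := inverse q
  r_unit := by rintro ⟨_, y, rfl⟩; rfl
  s_unit := by rintro ⟨_, y, rfl⟩; exact Subtype.ext (congrArg (unit A) (invAct_unit y))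
  r_mul _ _ _ := rfl
  s_mul q q' h := Subtype.ext (congrArg (unit A) (invAct_comp q q' (invAct_eq h)))
  mul_assoc _ _ _ _ _ := ext_iff' rfl (mul_assoc _ _ _ _ _)
  unit_mul q := ext_iff' rfl
    ((mul_congr (congrArg Subtype.val q.2) rfl _ (s_unit _)).trans (unit_mul _))
  mul_unit q := ext_iff' rfl
    ((mul_congr rfl (congrArg Subtype.val (p_invAct q)) _ (r_unit _).symm).trans (mul_unit _))
  r_inv _ := rfl
  s_inv q := Subtype.ext (congrArg (unit A) (invAct_inverse q))
  mul_inv q := ext_iff' rfl ((GroupoidStr.mul_inv _).trans (congrArg Subtype.val q.2.symm))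
  inv_mul q := ext_iff' rfl ((inv_mul _).trans (congrArg Subtype.val (p_invAct q).symm))

theorem continuous_unit : Continuous (unit A) :=
  Continuous.subtype_mk (by have := A.continuous_p; fun_prop) _

theorem continuous_fst : Continuous fun q : SemidirectProduct A => q.1.1 :=
  continuous_subtype_val.fst

theorem continuous_snd : Continuous fun q : SemidirectProduct A => q.1.2 :=
  continuous_subtype_val.snd

theorem continuous_invAct [IsLocallyCompactGroupoid G] :
    Continuous (invAct : SemidirectProduct A → Y) :=
  A.continuous_act.comp (f := fun q : SemidirectProduct A =>
      (⟨(inv q.1.2, q.1.1), (s_inv _).trans q.2.symm⟩ : {q : G × Y // s q.1 = A.p q.2}))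
    (((IsLocallyCompactGroupoid.continuous_inv.comp continuous_snd).prodMk
      continuous_fst).subtype_mk _)

/-- The semi-direct product is again a locally compact groupoid. -/
instance [IsLocallyCompactGroupoid G] : IsLocallyCompactGroupoid (SemidirectProduct A) where
  locallyCompactSpace := by
    have := A.locallyCompactSpace
    have := IsLocallyCompactGroupoid.locallyCompactSpace (G := G)
    have := IsLocallyCompactGroupoid.t2Space (G := G)
    have h : IsClosed {q : Y × G | A.p q.1 = r q.2} :=
      isClosed_eq (A.continuous_p.comp _root_.continuous_fst)
        (IsLocallyCompactGroupoid.continuous_r.comp _root_.continuous_snd)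
    exact h.isClosedEmbedding_subtypeVal.locallyCompactSpace
  t2Space := by
    have := A.t2Space
    have := IsLocallyCompactGroupoid.t2Space (G := G)
    exact inferInstanceAs (T2Space {q : Y × G // A.p q.1 = r q.2})
  continuous_r := (continuous_unit.comp continuous_fst).subtype_mk _
  continuous_s := (continuous_unit.comp continuous_invAct).subtype_mk _
  continuous_mul := by
    refine Continuous.subtype_mk (Continuous.prodMk
      (continuous_fst.comp continuous_subtype_val.fst) ?_) _
    exact IsLocallyCompactGroupoid.continuous_mul.comp
      (f := fun q : {q : SemidirectProduct A × SemidirectProduct A // s q.1 = r q.2} =>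
        (⟨(q.1.1.1.2, q.1.2.1.2), (p_invAct q.1.1).symm.trans
          ((congrArg A.p (invAct_eq q.2)).trans q.1.2.2)⟩ : {q : G × G // s q.1 = r q.2}))
      (((continuous_snd.comp continuous_subtype_val.fst).prodMk
        (continuous_snd.comp continuous_subtype_val.snd)).subtype_mk _)
  continuous_inv := (continuous_invAct.prodMk
    (IsLocallyCompactGroupoid.continuous_inv.comp continuous_snd)).subtype_mk _
  isOpenMap_r := by
    intro Ω hΩ
    obtain ⟨W, hW, rfl⟩ := isOpen_induced_iff.1 hΩ
    rw [isOpen_iff_mem_nhds]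
    rintro _ ⟨⟨⟨y, a⟩, hya⟩, hmem, rfl⟩
    obtain ⟨U, V, hU, hV, hyU, haV, hUV⟩ := isOpen_prod_iff.1 hW y a hmem
    have hO : IsOpen (U ∩ A.p ⁻¹' (r '' V)) :=
      hU.inter ((IsLocallyCompactGroupoid.isOpenMap_r V hV).preimage A.continuous_p)
    refine mem_of_superset ((hO.preimage (continuous_fst.comp continuous_subtype_val)).mem_nhds
      ⟨hyU, a, haV, hya.symm⟩) ?_
    rintro ⟨_, z, rfl⟩ ⟨hzU, b, hbV, hb⟩
    exact ⟨⟨(z, b), hb.symm⟩, hUV ⟨hzU, hbV⟩, rfl⟩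

end SemidirectProduct

/-- A `G`-action is amenable if the semi-direct product groupoid is amenable. -/
def GSpace.IsAmenable {G : Type u} [TopologicalSpace G] [GroupoidStr G]
    [IsLocallyCompactGroupoid G] {Y : Type v} [TopologicalSpace Y] (A : GSpace G Y) : Prop :=
  TopGpd.IsAmenable (SemidirectProduct A)

/-- Strong amenability at infinity: there is an amenable `G`-space `(Y, p)` such that `p` is proper
and has a continuous section. -/
def IsStronglyAmenableAtInfinity (G : Type u) [TopologicalSpace G] [GroupoidStr G]
    [IsLocallyCompactGroupoid G] : Prop :=
  ∃ (Y : Type u) (_ : TopologicalSpace Y) (A : GSpace G Y),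
    A.IsAmenable ∧ IsProperMap A.p ∧
      ∃ σ : units (G := G) → Y, Continuous σ ∧ ∀ x, A.p (σ x) = x

/-- The space `G *ᵣ G` of pairs of arrows with the same range, with the topology induced by
`G × G`. -/
abbrev RangePairs (G : Type u) [GroupoidStr G] : Type u := {q : G × G // r q.1 = r q.2}

/-- The map `(a, b) ↦ a⁻¹ b` on `G *ᵣ G`. -/
def invMul {G : Type u} [GroupoidStr G] (q : RangePairs G) : G :=
  mul (inv q.1.1) q.1.2 ((s_inv _).trans q.2)

/-- A tube: a subset of `G *ᵣ G` whose image by `(a, b) ↦ a⁻¹ b` is relatively compact in `G`. -/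
def IsTube {G : Type u} [TopologicalSpace G] [GroupoidStr G] (T : Set (RangePairs G)) : Prop :=
  IsCompact (closure (invMul '' T))

/-- Positive definite kernels on `G *ᵣ G` (in `ℂ`, `0 ≤ z` means that `z` is real and
nonnegative). -/
def IsPositiveDefiniteKernel {G : Type u} [GroupoidStr G] (k : RangePairs G → ℂ) : Prop :=
  ∀ (x : units (G := G)) (n : ℕ) (a : Fin n → RFiber G x) (c : Fin n → ℂ),
    0 ≤ ∑ i, ∑ j, conj (c i) * c j * k ⟨((a i).1, (a j).1), (a i).2.trans (a j).2.symm⟩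

end TopGpd

/-!
Both implications rest on a description of the amenability of an étale groupoid `H` (applied to
`H = Y ⋊ G`): `H` is amenable if and only if for every compact `K ⊆ H` and every `ε > 0` there is a
continuous, compactly supported function `h` on `H` of positive type, that is, with
`(a, b) ↦ h (a⁻¹ b)` positive definite, such that `|h - 1| ≤ ε` on `K`.

* `IsAmenable.exists_positive_type`. The range fibres are discrete, so the measures `m` have a
  density with respect to the counting measures. By Dini's argument (`exists_cutoff`) a compactly
  supported cutoff `ψ` retains almost all of the mass over a compact set of units. The coefficient
  `a ↦ ∑ u(b) u(a⁻¹ b)` of `u = √(ψ m)` is of positive type, and close to `1` where `m` is nearly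
  invariant.
* `isAmenable_of_exists_positive_type`. Conversely, `h` is uniformly close to a coefficient of a
  compactly supported `f` (`exists_approx_sqrt`). Here `f = p(h)` in the convolution algebra, for a
  real polynomial `p` without constant term such that `p(t)²` approximates `t` on an interval
  containing the spectra of convolution by `h` on the fibres; no completion is needed, because that
  operator has finite propagation, so that its polynomials can be read off large finite sections,
  which are positive semidefinite matrices. The functions `|f|²` on the fibres have sums close
  to `1` near the given compact set and are nearly invariant; `density` corrects them to probability
  densities everywhere by adding the missing mass at the unit (the units are open) or rescaling.

Given an amenable `G`-space `(Y, p)` with `p` proper and a section `σ`, functions of positive type on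
`Y ⋊ G` are pulled back by `a ↦ (σ (r a), a)`. Properness of `p` makes
`{(y, a) | a ∈ K}` compact, which gives the uniform convergence on tubes.

Given kernels `k j` on `G *ᵣ G`, let `Y` be the space of *all* families of positive definite kernels,
each on one single range fibre `Gˣ`, which satisfy the same bounds as the `k j`, the same support
conditions and the same estimates of the distance to `1` on tubes (`KernelFamily.Space`). With the
vague topology, `y ↦ x` is proper, by Tychonoff's theorem (`FiberMaps.exists_ultrafilter_le_nhds`)
and because all constraints are closed (`KernelFamily.Admissible.of_ultrafilter`). The groupoid acts
by translation, `x ↦ (k j restricted to Gˣ)` is a continuous section, and the tautological functions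
`(y, a) ↦ y j (r a, a)` on `Y ⋊ G` are compactly supported, of positive type and close to `1` on
large compact sets, so that `Y ⋊ G` is amenable.
-/

/-! ### Sums over the fibres of a local homeomorphism -/

namespace TopGpd

section FiberSum

variable {E X Z M : Type*} [TopologicalSpace E] [TopologicalSpace X] [TopologicalSpace Z]

/-- Inverses of the charts of a local homeomorphism, extended by junk values, are local
sections. -/
theorem exists_localSection {q : E → X} (hq : IsLocalHomeomorph q) (e : E) :
    ∃ s : X → E, s (q e) = e ∧ ContinuousAt s (q e) ∧ (∀ᶠ x in 𝓝 (q e), q (s x) = x) ∧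
      ∀ᶠ e' in 𝓝 e, s (q e') = e' := by
  obtain ⟨φ, he, rfl⟩ := hq e
  refine ⟨φ.symm, φ.left_inv he, φ.symm.continuousAt (by simpa using φ.map_source he), ?_, ?_⟩
  · filter_upwards [φ.open_target.mem_nhds (φ.map_source he)] with x hx using φ.right_inv hx
  · filter_upwards [φ.open_source.mem_nhds he] with e' he' using φ.left_inv he'

/-- A local section through `e` of the local homeomorphism `q`; it is only meaningful near `q e`. -/
noncomputable def localSection {q : E → X} (hq : IsLocalHomeomorph q) (e : E) : X → E :=
  (exists_localSection hq e).choose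

variable {q : E → X} (hq : IsLocalHomeomorph q) (e : E)

theorem localSection_apply : localSection hq e (q e) = e :=
  (exists_localSection hq e).choose_spec.1

theorem continuousAt_localSection : ContinuousAt (localSection hq e) (q e) :=
  (exists_localSection hq e).choose_spec.2.1

theorem eventually_apply_localSection : ∀ᶠ x in 𝓝 (q e), q (localSection hq e x) = x :=
  (exists_localSection hq e).choose_spec.2.2.1

theorem eventually_localSection_apply : ∀ᶠ e' in 𝓝 e, localSection hq e (q e') = e' :=
  (exists_localSection hq e).choose_spec.2.2.2

theorem tendsto_localSection : Tendsto (localSection hq e) (𝓝 (q e)) (𝓝 e) := by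
  simpa [ContinuousAt, localSection_apply] using continuousAt_localSection hq e

include hq in
/-- Fibres of a local homeomorphism meet compact sets in finite sets. -/
theorem finite_inter_fiber [T1Space X] {K : Set E} (hK : IsCompact K) (x : X) :
    (K ∩ q ⁻¹' {x}).Finite := by
  have hc : IsCompact (K ∩ q ⁻¹' {x}) := hK.inter_right (isClosed_singleton.preimage hq.continuous)
  obtain ⟨t, -, ht⟩ := hc.elim_nhds_subcover
    (fun e => {e' | localSection hq e (q e') = e'})
    (fun e _ => eventually_localSection_apply hq e)
  refine (t.finite_toSet.image fun e => localSection hq e x).subset fun e' he' => ?_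
  obtain ⟨e, het, he⟩ := Set.mem_iUnion₂.1 (ht he')
  exact ⟨e, het, by rw [← (he'.2 : q e' = x)]; exact he⟩

include hq in
theorem finite_support_fiber [T1Space X] [Zero M] {K : Set E} (hK : IsCompact K) {x : X} {g : E → M}
    (hg : ∀ e, q e = x → e ∉ K → g e = 0) :
    (Function.support fun e : {e // q e = x} => g e.1).Finite := by
  refine Set.Finite.of_finite_image ((finite_inter_fiber hq hK x).subset ?_)
    Subtype.val_injective.injOn
  rintro _ ⟨⟨e, he⟩, hne, rfl⟩
  exact ⟨by_contra fun h => hne (hg e he h), he⟩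

/-- Near `x`, the part of a fibre which lies in a given compact set is described by finitely many
local sections. -/
theorem eventually_finsum_fiber_eq [T2Space E] [T2Space X] [AddCommMonoid M] {K : Set E}
    (hK : IsCompact K) (x : X) :
    ∀ᶠ x' in 𝓝 x, ∀ g : E → M, (∀ e', q e' = x' → e' ∉ K → g e' = 0) →
      ∑ᶠ e' : {e' // q e' = x'}, g e'.1 =
        ∑ e ∈ (finite_inter_fiber hq hK x).toFinset, g (localSection hq e x') := by
  classical
  set T := (finite_inter_fiber hq hK x).toFinset with hT
  have hTx : ∀ e ∈ T, q e = x := fun e he => by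
    have : e ∈ K ∩ q ⁻¹' {x} := by simpa [hT] using he
    exact this.2
  have h1 : ∀ᶠ x' in 𝓝 x, ∀ e ∈ T, q (localSection hq e x') = x' := by
    rw [Filter.eventually_all_finset]
    intro e he
    have := eventually_apply_localSection hq e
    rwa [hTx e he] at this
  -- distinct sections stay distinct near `x`
  have h2 : ∀ᶠ x' in 𝓝 x, ∀ e ∈ T, ∀ e₂ ∈ T, localSection hq e x' = localSection hq e₂ x' →
      e = e₂ := by
    simp_rw [Filter.eventually_all_finset]
    intro e he e₂ he₂
    by_cases hne : e = e₂
    · exact Eventually.of_forall fun _ _ => hne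
    · have t1 := tendsto_localSection hq e
      have t2 := tendsto_localSection hq e₂
      rw [hTx e he] at t1
      rw [hTx e₂ he₂] at t2
      obtain ⟨U, V, hU, hV, heU, heV, hUV⟩ := t2_separation hne
      filter_upwards [t1 (hU.mem_nhds heU), t2 (hV.mem_nhds heV)] with x' a b hab
      exact (Set.disjoint_left.1 hUV a (hab ▸ b)).elim
  -- points of `K` off the ranges of these sections lie over a closed set which avoids `x`
  have h3 : ∀ᶠ x' in 𝓝 x, ∀ e', q e' = x' → e' ∈ K → ∃ e ∈ T, localSection hq e x' = e' := by
    set W : Set E := ⋃ e ∈ T, interior {e' | localSection hq e (q e') = e'} with hW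
    have hWo : IsOpen W := isOpen_biUnion fun e _ => isOpen_interior
    have hc : IsClosed (q '' (K \ W)) := ((hK.diff hWo).image hq.continuous).isClosed
    have hx : x ∉ q '' (K \ W) := by
      rintro ⟨e, ⟨heK, heW⟩, hex⟩
      apply heW
      refine Set.mem_biUnion (x := e) (by simpa [hT] using ⟨heK, hex⟩) ?_
      exact mem_interior_iff_mem_nhds.2 (eventually_localSection_apply hq e)
    filter_upwards [hc.isOpen_compl.mem_nhds hx] with x' hx' e' he' heK
    have : e' ∈ W := by
      by_contra hn
      exact hx' ⟨e', ⟨heK, hn⟩, he'⟩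
    obtain ⟨e, heT, he⟩ := Set.mem_iUnion₂.1 this
    refine ⟨e, heT, ?_⟩
    have := interior_subset he
    rw [Set.mem_ofPred_eq, he'] at this
    exact this
  filter_upwards [h1, h2, h3] with x' h1 h2 h3 g hg
  rw [finsum_eq_sum_of_support_subset (s := T.attach.image
    fun e => (⟨localSection hq e.1 x', h1 e.1 e.2⟩ : {e' // q e' = x'}))]
  · rw [Finset.sum_image]
    · exact Finset.sum_attach T fun e => g (localSection hq e x')
    · intro e _ e₂ _ h
      exact Subtype.ext (h2 _ e.2 _ e₂.2 (congrArg Subtype.val h))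
  · rintro ⟨e', he'⟩ hne
    have : e' ∈ K := by
      by_contra hn
      exact hne (hg e' he' hn)
    obtain ⟨e, he, hee⟩ := h3 e' he' this
    simp only [Finset.coe_image, Set.mem_image]
    exact ⟨⟨e, he⟩, by simp, Subtype.ext hee⟩

include hq in
/-- Continuity of fibrewise sums: if `F` is continuous on the fibre product of `Z` and `E` over `X`
and vanishes off a compact set of `E`, its sums over the fibres depend continuously on the
parameter. -/
theorem continuous_finsum_fiber [T2Space E] [T2Space X] [AddCommMonoid M] [TopologicalSpace M]
    [ContinuousAdd M] {p : Z → X} (hp : Continuous p) {K : Set E} (hK : IsCompact K)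
    {F : Z → E → M} (hF : ContinuousOn (fun z : Z × E => F z.1 z.2) {z | q z.2 = p z.1})
    (hFK : ∀ z e, q e = p z → e ∉ K → F z e = 0) :
    Continuous fun z => ∑ᶠ e : {e // q e = p z}, F z e.1 := by
  rw [continuous_iff_continuousAt]
  intro z₀
  have hev := hp.continuousAt.eventually (eventually_finsum_fiber_eq (M := M) hq hK (p z₀))
  set T := (finite_inter_fiber hq hK (p z₀)).toFinset with hT
  have hc : ContinuousAt (fun z => ∑ e ∈ T, F z (localSection hq e (p z))) z₀ := by
    refine tendsto_finsetSum _ fun e he => ?_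
    have hex : q e = p z₀ := by
      have : e ∈ K ∩ q ⁻¹' {p z₀} := by simpa [hT] using he
      exact this.2
    have hs : ∀ᶠ z in 𝓝 z₀, q (localSection hq e (p z)) = p z := by
      have := eventually_apply_localSection hq e
      rw [hex] at this
      exact hp.continuousAt.eventually this
    have ht : Tendsto (fun z => localSection hq e (p z)) (𝓝 z₀) (𝓝 e) := by
      have := tendsto_localSection hq e
      rw [hex] at this
      exact this.comp hp.continuousAt
    have h1 : Tendsto (fun z => (z, localSection hq e (p z))) (𝓝 z₀)
        (𝓝[{z | q z.2 = p z.1}] (z₀, e)) :=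
      tendsto_nhdsWithin_iff.2 ⟨tendsto_id.prodMk_nhds ht, hs⟩
    have h2 := (hF (z₀, e) hex).tendsto.comp h1
    have : localSection hq e (p z₀) = e := by rw [← hex, localSection_apply]
    simpa [this, Function.comp_def] using h2
  refine hc.congr ?_
  filter_upwards [hev] with z hz
  exact (hz (F z) (hFK z)).symm

include hq in
/-- A compactly supported bump function equal to `1` near `e` whose support contains at most one
point of every fibre. -/
theorem exists_bump [LocallyCompactSpace E] [T2Space E] :
    ∃ ψ : E → ℝ, Continuous ψ ∧ HasCompactSupport ψ ∧ (∀ᶠ e' in 𝓝 e, ψ e' = 1) ∧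
      (∀ e', ψ e' ∈ Set.Icc (0 : ℝ) 1) ∧
      ∀ e₁ e₂, ψ e₁ ≠ 0 → ψ e₂ ≠ 0 → q e₁ = q e₂ → e₁ = e₂ := by
  have hW := mem_interior_iff_mem_nhds.2 (eventually_localSection_apply hq e)
  obtain ⟨C, hC, heC, hCW⟩ := exists_compact_subset isOpen_interior hW
  obtain ⟨ψ, h1, h2, h3, h4⟩ := exists_continuousMap_one_of_isCompact_subset_isOpen hC
    isOpen_interior hCW
  refine ⟨ψ, ψ.continuous, h2, ?_, h4, fun e₁ e₂ g1 g2 h => ?_⟩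
  · filter_upwards [isOpen_interior.mem_nhds heC] with e' he' using h1 (interior_subset he')
  · have a1 := interior_subset (h3 (subset_tsupport _ g1))
    have a2 := interior_subset (h3 (subset_tsupport _ g2))
    rw [Set.mem_ofPred_eq] at a1 a2
    rw [← a1, ← a2, h]

end FiberSum

/-- If the support of `ψ` meets each fibre in at most one point, fibre sums weighted by `ψ` have
a single term. -/
theorem finsum_fiber_mul_eq {E X R : Type*} [Semiring R] {q : E → X} {ψ g : E → R} {e : E}
    (he : ψ e ≠ 0)
    (hψ : ∀ e₁ e₂, ψ e₁ ≠ 0 → ψ e₂ ≠ 0 → q e₁ = q e₂ → e₁ = e₂) :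
    ∑ᶠ e' : {e' // q e' = q e}, ψ e'.1 * g e'.1 = ψ e * g e := by
  rw [finsum_eq_single _ (⟨e, rfl⟩ : {e' // q e' = q e})]
  rintro ⟨e', he'⟩ hne
  by_cases h : ψ e' = 0
  · simp [h]
  · exact (hne (Subtype.ext (hψ e' e h he he'))).elim

end TopGpd

/-! ### Left division in a groupoid -/

namespace TopGpd

open GroupoidStr

section Algebra

variable {G : Type u} [GroupoidStr G]

open Classical in
/-- The left quotient `a⁻¹ b` of arrows with the same range, extended by the junk value `b` to all
pairs of arrows. -/
noncomputable def ldiv (a b : G) : G := if h : r a = r b then invMul ⟨(a, b), h⟩ else b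

theorem ldiv_eq {a b : G} (h : r a = r b) : ldiv a b = invMul ⟨(a, b), h⟩ := dif_pos h

theorem ldiv_eq_mul {a b : G} (h : r a = r b) :
    ldiv a b = mul (inv a) b ((s_inv _).trans h) := ldiv_eq h

theorem inv_inv' (a : G) : inv (inv a) = a :=
  (eq_inv_of_mul_eq (inv a) a (r_inv a).symm (by rw [GroupoidStr.mul_inv, s_inv])).symm

theorem r_ldiv {a b : G} (h : r a = r b) : r (ldiv a b) = s a := by
  rw [ldiv_eq_mul h, r_mul, r_inv]

theorem s_ldiv {a b : G} (h : r a = r b) : s (ldiv a b) = s b := by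
  rw [ldiv_eq_mul h, s_mul]

theorem inv_mul_cancel_left' (a b : G) (h : s a = r b) : ldiv a (mul a b h) = b := by
  rw [ldiv_eq_mul (r_mul a b h).symm, ← mul_assoc _ _ _ (s_inv a) h]
  calc _ = mul (r b : G) b (s_unit _) := mul_congr (by rw [inv_mul, h]) rfl _ _
    _ = b := unit_mul b

theorem mul_ldiv {a b : G} (h : r a = r b) : mul a (ldiv a b) (r_ldiv h).symm = b := by
  have h1 : s (inv a) = r b := (s_inv a).trans h
  calc mul a (ldiv a b) (r_ldiv h).symm
      = mul a (mul (inv a) b h1) ((r_inv a).symm.trans (r_mul _ _ _).symm) :=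
        mul_congr rfl (ldiv_eq_mul h) _ _
    _ = mul (mul a (inv a) (r_inv a).symm) b ((s_mul _ _ _).trans h1) :=
        (mul_assoc _ _ _ _ _).symm
    _ = mul (r b : G) b (s_unit _) := mul_congr (by rw [GroupoidStr.mul_inv, h]) rfl _ _
    _ = b := unit_mul b

theorem mul_left_cancel' {a b c : G} (hb : s a = r b) (hc : s a = r c)
    (h : mul a b hb = mul a c hc) : b = c := by
  rw [← inv_mul_cancel_left' a b hb, h, inv_mul_cancel_left']

/-- The identity `(a⁻¹ b)⁻¹ (a⁻¹ c) = b⁻¹ c`. -/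
theorem ldiv_ldiv {a b c : G} (hb : r a = r b) (hc : r a = r c) :
    ldiv (ldiv a b) (ldiv a c) = ldiv b c := by
  have hbc : r b = r c := hb.symm.trans hc
  have h1 : r (ldiv a b) = r (ldiv a c) := (r_ldiv hb).trans (r_ldiv hc).symm
  have h2 : s (ldiv a b) = r (ldiv b c) := (s_ldiv hb).trans (r_ldiv hbc).symm
  have key : mul (ldiv a b) (ldiv b c) h2 = ldiv a c := by
    refine mul_left_cancel' (a := a) ((r_ldiv hb).symm.trans (r_mul _ _ _).symm)
      (r_ldiv hc).symm ?_
    rw [mul_ldiv hc, ← mul_assoc a (ldiv a b) (ldiv b c) (r_ldiv hb).symm h2]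
    exact (mul_congr (mul_ldiv hb) rfl _ (r_ldiv hbc).symm).trans (mul_ldiv hbc)
  rw [← key, inv_mul_cancel_left']

theorem ldiv_self (a : G) : ldiv a a = s a := by rw [ldiv_eq_mul rfl, inv_mul]

theorem ldiv_unit_left {x : units (G := G)} {b : G} (h : r b = x) : ldiv (x : G) b = b := by
  rw [ldiv_eq_mul ((r_unit x).trans h.symm)]
  refine (mul_congr ?_ rfl _ (s_unit _)).trans (unit_mul b)
  rw [inv_unit, h]

theorem ldiv_unit_right {a : G} {x : units (G := G)} (h : r a = x) : ldiv a (x : G) = inv a := by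
  rw [ldiv_eq_mul (h.trans (r_unit x).symm)]
  refine (mul_congr rfl ?_ _ (r_unit _).symm).trans (mul_unit (inv a))
  rw [s_inv, h]

theorem inv_ldiv {a b : G} (h : r a = r b) : inv (ldiv a b) = ldiv b a := by
  rw [← ldiv_unit_right (r_ldiv h), ← ldiv_self, ldiv_ldiv h rfl]

/-- Left translation `b ↦ a⁻¹ b` as a bijection of the range fibres over `r a` and `s a`. -/
noncomputable def ldivEquiv (a : G) {x y : units (G := G)} (hx : r a = x) (hy : s a = y) :
    RFiber G x ≃ RFiber G y where
  toFun b := ⟨ldiv a b.1, (r_ldiv (hx.trans b.2.symm)).trans hy⟩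
  invFun b := ⟨mul a b.1 (hy.trans b.2.symm), (r_mul _ _ _).trans hx⟩
  left_inv b := Subtype.ext (mul_ldiv (hx.trans b.2.symm))
  right_inv _ := Subtype.ext (inv_mul_cancel_left' _ _ _)

theorem leftTranslation_eq (a : G) : leftTranslation a = (ldivEquiv a rfl rfl).symm := rfl

theorem invMul_eq (q : RangePairs G) : invMul q = ldiv q.1.1 q.1.2 := (ldiv_eq q.2).symm

/-- For the kernel `(a, b) ↦ h (a⁻¹ b)`, positive definiteness expressed with `ldiv`. -/
theorem isPositiveDefiniteKernel_comp_invMul_iff {h : G → ℂ} :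
    IsPositiveDefiniteKernel (fun q : RangePairs G => h (invMul q)) ↔
      ∀ (x : units (G := G)) (n : ℕ) (a : Fin n → RFiber G x) (c : Fin n → ℂ),
        0 ≤ ∑ i, ∑ j, conj (c i) * c j * h (ldiv (a i).1 (a j).1) := by
  simp only [IsPositiveDefiniteKernel, invMul_eq]

end Algebra

section Topology

variable {G : Type u} [TopologicalSpace G] [GroupoidStr G] [IsLocallyCompactGroupoid G]

instance instT2Space : T2Space G := IsLocallyCompactGroupoid.t2Space

instance instLocallyCompactSpace : LocallyCompactSpace G :=
  IsLocallyCompactGroupoid.locallyCompactSpace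

theorem continuous_r : Continuous (r : G → units (G := G)) := IsLocallyCompactGroupoid.continuous_r

theorem continuous_s : Continuous (s : G → units (G := G)) := IsLocallyCompactGroupoid.continuous_s

theorem continuous_invMul : Continuous (invMul : RangePairs G → G) :=
  (IsLocallyCompactGroupoid.continuous_mul (G := G)).comp
    (f := fun q : RangePairs G =>
      (⟨(inv q.1.1, q.1.2), (s_inv _).trans q.2⟩ : {q : G × G // s q.1 = r q.2}))
    (((IsLocallyCompactGroupoid.continuous_inv.comp continuous_subtype_val.fst).prodMk
      continuous_subtype_val.snd).subtype_mk _)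

theorem continuousOn_ldiv : ContinuousOn (fun q : G × G => ldiv q.1 q.2) {q | r q.1 = r q.2} := by
  rw [continuousOn_iff_continuous_domRestrict]
  exact continuous_invMul.congr fun q => invMul_eq (G := G) ⟨q.1, q.2⟩

theorem ContinuousOn.ldiv {Z : Type*} [TopologicalSpace Z] {S : Set Z} {f g : Z → G}
    (hf : ContinuousOn f S) (hg : ContinuousOn g S) (h : ∀ z ∈ S, r (f z) = r (g z)) :
    ContinuousOn (fun z => ldiv (f z) (g z)) S :=
  continuousOn_ldiv.comp (hf.prodMk hg) h

theorem isClosed_rangePairs : IsClosed {q : G × G | r q.1 = r q.2} :=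
  isClosed_eq (continuous_r.comp continuous_fst) (continuous_r.comp continuous_snd)

theorem continuous_inv' : Continuous (inv : G → G) := IsLocallyCompactGroupoid.continuous_inv

/-- Products `a = b c` of arrows from two compact sets form a compact set. -/
theorem isCompact_setOf_ldiv_mem {K L : Set G} (hK : IsCompact K) (hL : IsCompact L) :
    IsCompact {a : G | ∃ b ∈ K, r b = r a ∧ ldiv b a ∈ L} := by
  have hc : IsCompact ((K ×ˢ L) ∩ {q : G × G | s q.1 = r q.2}) :=
    (hK.prod hL).inter_right (isClosed_eq (continuous_s.comp continuous_fst)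
      (continuous_r.comp continuous_snd))
  have hcont : ContinuousOn (fun q : G × G => ldiv (inv q.1) q.2)
      ((K ×ˢ L) ∩ {q : G × G | s q.1 = r q.2}) :=
    ContinuousOn.ldiv (continuous_inv'.comp continuous_fst).continuousOn
      continuous_snd.continuousOn fun q hq => (r_inv _).trans hq.2
  have hmul : ∀ {b c : G} (h : s b = r c), ldiv (inv b) c = mul b c h := fun {b c} h => by
    rw [ldiv_eq_mul ((r_inv _).trans h)]
    exact mul_congr (inv_inv' b) rfl _ _
  convert hc.image_of_continuousOn hcont using 1
  ext a
  constructor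
  · rintro ⟨b, hb, hba, hL⟩
    exact ⟨(b, ldiv b a), ⟨⟨hb, hL⟩, (r_ldiv hba).symm⟩,
      (hmul (r_ldiv hba).symm).trans (mul_ldiv hba)⟩
  · rintro ⟨⟨b, c⟩, ⟨⟨hb, hc⟩, hbc⟩, rfl⟩
    have hbc : s b = r c := hbc
    change ∃ b' ∈ K, r b' = r (ldiv (inv b) c) ∧ ldiv b' (ldiv (inv b) c) ∈ L
    refine ⟨b, hb, ?_⟩
    rw [hmul hbc, inv_mul_cancel_left']
    exact ⟨(r_mul _ _ _).symm, hc⟩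

/-- Quotients `a = b c⁻¹` of arrows from two compact sets form a compact set. -/
theorem isCompact_setOf_ldiv_mem' {K L : Set G} (hK : IsCompact K) (hL : IsCompact L) :
    IsCompact {a : G | ∃ b ∈ K, r a = r b ∧ ldiv a b ∈ L} := by
  convert isCompact_setOf_ldiv_mem hK (hL.image continuous_inv') using 1
  ext a
  refine exists_congr fun b => and_congr_right fun _ => ⟨fun h => ⟨h.1.symm, _, h.2, ?_⟩, ?_⟩
  · exact inv_ldiv h.1
  · rintro ⟨h, c, hc, hca⟩
    refine ⟨h.symm, ?_⟩
    rwa [← inv_ldiv h, ← hca, inv_inv']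

end Topology

section Etale

variable {G : Type u} [TopologicalSpace G] [GroupoidStr G] [IsEtaleGroupoid G]

theorem isLocalHomeomorph_r : IsLocalHomeomorph (r : G → units (G := G)) :=
  IsEtaleGroupoid.isLocalHomeomorph_r

instance discreteTopology_rFiber (x : units (G := G)) : DiscreteTopology (RFiber G x) := by
  rw [discreteTopology_iff_isOpen_singleton]
  rintro ⟨a, ha⟩
  refine isOpen_iff_mem_nhds.2 ?_
  rintro _ rfl
  have h := eventually_localSection_apply (isLocalHomeomorph_r (G := G)) a
  have h' := (continuous_subtype_val (p := fun b : G => r b = x)).continuousAt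
    (x := ⟨a, ha⟩) |>.eventually h
  filter_upwards [h'] with b hb
  refine Subtype.ext ?_
  change b.1 = a
  rw [← hb, b.2, ← ha, localSection_apply]

/-- The units of an étale groupoid form a clopen set. -/
theorem isClopen_units : IsClopen (units (G := G)) := by
  have hc : Continuous fun a : G => (r a : G) := continuous_subtype_val.comp continuous_r
  have hu : units (G := G) = {a : G | a = r a} := by
    ext a
    exact ⟨fun ha => (congrArg Subtype.val (r_unit ⟨a, ha⟩)).symm, fun ha => by
      rw [show a = r a from ha]; exact (r a).2⟩
  refine ⟨hu ▸ isClosed_eq continuous_id hc, isOpen_iff_mem_nhds.2 fun a ha => ?_⟩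
  have h := eventually_localSection_apply (isLocalHomeomorph_r (G := G)) a
  have har : (r a : G) = a := congrArg Subtype.val (r_unit ⟨a, ha⟩)
  have h2 : ∀ᶠ b in 𝓝 a, localSection isLocalHomeomorph_r a (r (r b : G)) = (r b : G) := by
    have := hc.continuousAt (x := a)
    rw [ContinuousAt, har] at this
    exact this.eventually h
  -- both `b` and `r b` are the point over `r b` of the local section through the unit `a`
  filter_upwards [h, h2] with b h1 h2
  rw [r_unit, h1] at h2
  rw [h2]
  exact (r b).2

end Etale

end TopGpd

/-! ### Probability measures on discrete spaces -/

namespace TopGpd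

section Discrete

variable {α : Type*} [MeasurableSpace α]

theorem normDiff_nonneg (μ ν : ProbabilityMeasure α) : 0 ≤ normDiff μ ν := ENNReal.toReal_nonneg

/-- The total variation norm computed from a Hahn decomposition. -/
theorem exists_normDiff_eq (μ ν : ProbabilityMeasure α) :
    ∃ B : Set α, MeasurableSet B ∧
      normDiff μ ν = ((μ : Measure α).real B - (ν : Measure α).real B)
        - ((μ : Measure α).real Bᶜ - (ν : Measure α).real Bᶜ) ∧
      (∀ C ⊆ B, MeasurableSet C → 0 ≤ (μ : Measure α).real C - (ν : Measure α).real C) ∧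
      ∀ C ⊆ Bᶜ, MeasurableSet C → (μ : Measure α).real C - (ν : Measure α).real C ≤ 0 := by
  set τ := (μ : Measure α).toSignedMeasure - (ν : Measure α).toSignedMeasure with hτ
  have happ : ∀ C, MeasurableSet C → τ C = (μ : Measure α).real C - (ν : Measure α).real C :=
    fun C hC => Measure.toSignedMeasure_sub_apply hC
  obtain ⟨B, hB, h1, h2, h3, h4⟩ := τ.toJordanDecomposition_spec
  refine ⟨B, hB, ?_, fun C hC hCm => ?_, fun C hC hCm => ?_⟩
  · rw [normDiff, ← hτ, SignedMeasure.totalVariation, h3, h4, Measure.add_apply, ENNReal.toReal_add]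
    · have e1 := τ.toMeasureOfZeroLE_real_apply h1 hB MeasurableSet.univ
      have e2 := τ.toMeasureOfLEZero_real_apply h2 hB.compl MeasurableSet.univ
      rw [Set.inter_univ, happ _ hB] at e1
      rw [Set.inter_univ, happ _ hB.compl] at e2
      rw [measureReal_def] at e1 e2
      rw [e1, e2]; ring
    · exact measure_ne_top _ _
    · exact measure_ne_top _ _
  · rw [← happ C hCm]
    exact τ.nonneg_of_zero_le_restrict (τ.zero_le_restrict_subset hB hC h1)
  · rw [← happ C hCm]
    exact τ.nonpos_of_restrict_le_zero (τ.restrict_le_zero_subset hB.compl hC h2)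

variable [MeasurableSingletonClass α]

/-- The total variation norm dominates the partial `ℓ¹` norms of the differences of point masses. -/
theorem sum_abs_sub_le_normDiff (μ ν : ProbabilityMeasure α) (S : Finset α) :
    ∑ b ∈ S, |(μ : Measure α).real {b} - (ν : Measure α).real {b}| ≤ normDiff μ ν := by
  classical
  obtain ⟨B, hB, h, hpos, hneg⟩ := exists_normDiff_eq μ ν
  -- on each half of the Hahn decomposition the point masses add up to a set mass
  have key : ∀ T : Finset α, ∑ b ∈ T, ((μ : Measure α).real {b} - (ν : Measure α).real {b})
      = (μ : Measure α).real T - (ν : Measure α).real T := fun T => by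
    rw [Finset.sum_sub_distrib, sum_measureReal_singleton, sum_measureReal_singleton]
  have split : ∀ (ρ : ProbabilityMeasure α) (T : Finset α) (A : Set α), (T : Set α) ⊆ A →
      MeasurableSet A → (ρ : Measure α).real A
        = (ρ : Measure α).real T + (ρ : Measure α).real (A \ T) := fun ρ T A hTA hA => by
    rw [← measureReal_union Set.disjoint_sdiff_right (hA.diff T.measurableSet),
      Set.union_sdiff_cancel hTA]
  rw [h, ← Finset.sum_filter_add_sum_filter_not S (· ∈ B), sub_eq_add_neg]
  have hS1 : ((S.filter (· ∈ B) : Finset α) : Set α) ⊆ B := fun b hb => by simp_all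
  have hS2 : ((S.filter (· ∉ B) : Finset α) : Set α) ⊆ Bᶜ := fun b hb => by simp_all
  refine add_le_add ?_ ?_
  · rw [Finset.sum_congr rfl fun b hb => abs_of_nonneg
      (hpos {b} (by simpa using (Finset.mem_filter.1 hb).2) (measurableSet_singleton b)), key]
    have := hpos (B \ (S.filter (· ∈ B) : Finset α)) Set.sdiff_subset
      (hB.diff (Finset.measurableSet _))
    rw [split μ _ B hS1 hB, split ν _ B hS1 hB]
    linarith
  · rw [Finset.sum_congr rfl fun b hb => abs_of_nonpos
      (hneg {b} (by simpa using (Finset.mem_filter.1 hb).2) (measurableSet_singleton b)),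
      Finset.sum_neg_distrib, key]
    have := hneg (Bᶜ \ (S.filter (· ∉ B) : Finset α)) Set.sdiff_subset
      (hB.compl.diff (Finset.measurableSet _))
    rw [split μ _ Bᶜ hS2 hB.compl, split ν _ Bᶜ hS2 hB.compl]
    linarith

/-- For measures carried by a finite set the total variation norm is at most the `ℓ¹` norm. -/
theorem normDiff_le_sum_abs_sub (μ ν : ProbabilityMeasure α) (S : Finset α)
    (hμ : (μ : Measure α) (S : Set α)ᶜ = 0) (hν : (ν : Measure α) (S : Set α)ᶜ = 0) :
    normDiff μ ν ≤ ∑ b ∈ S, |(μ : Measure α).real {b} - (ν : Measure α).real {b}| := by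
  classical
  obtain ⟨B, hB, h, -⟩ := exists_normDiff_eq μ ν
  have key : ∀ ρ : ProbabilityMeasure α, (ρ : Measure α) (S : Set α)ᶜ = 0 → ∀ A : Set α,
      (ρ : Measure α).real A = ∑ b ∈ S.filter (· ∈ A), (ρ : Measure α).real {b} := by
    intro ρ hρ A
    rw [sum_measureReal_singleton]
    refine measureReal_congr ?_
    have hS : ∀ᵐ b ∂(ρ : Measure α), b ∈ S := by
      rw [ae_iff]; exact hρ
    filter_upwards [hS] with b hb
    exact propext ⟨fun hA => by simpa using ⟨hb, hA⟩, fun hA => (Finset.mem_filter.1 hA).2⟩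
  rw [h, key μ hμ, key ν hν, key μ hμ, key ν hν, ← Finset.sum_sub_distrib,
    ← Finset.sum_sub_distrib, ← Finset.sum_filter_add_sum_filter_not S (· ∈ B), sub_eq_add_neg,
    ← Finset.sum_neg_distrib]
  exact add_le_add (Finset.sum_le_sum fun b _ => le_abs_self _)
    (by simpa only [Set.mem_compl_iff] using Finset.sum_le_sum fun b _ => neg_le_abs _)

theorem integral_eq_sum_of_support_subset {E : Type*} [NormedAddCommGroup E] [NormedSpace ℝ E]
    [CompleteSpace E]
    (μ : Measure α) [IsFiniteMeasure μ] {f : α → E} {S : Finset α}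
    (hf : ∀ b ∉ S, f b = 0) : ∫ b, f b ∂μ = ∑ b ∈ S, μ.real {b} • f b := by
  rw [← setIntegral_eq_integral_of_forall_compl_eq_zero (s := (S : Set α)) (fun b hb => hf b hb)]
  exact setIntegral_finset _ IntegrableOn.finset

/-- Regular probability measures on discrete spaces are almost concentrated on finite sets. -/
theorem exists_finset_lt_measureReal [TopologicalSpace α] [DiscreteTopology α]
    (μ : ProbabilityMeasure α) (hμ : (μ : Measure α).Regular) {c : ℝ} (hc : c < 1) :
    ∃ S : Finset α, c < ∑ b ∈ S, (μ : Measure α).real {b} := by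
  have h1 : ENNReal.ofReal c < (μ : Measure α) Set.univ := by
    rw [measure_univ]
    exact ENNReal.ofReal_lt_one.2 hc
  obtain ⟨K, -, hK, hcK⟩ := hμ.innerRegular isOpen_univ _ h1
  refine ⟨hK.finite_of_discrete.toFinset, ?_⟩
  rw [sum_measureReal_singleton, Set.Finite.coe_toFinset]
  refine lt_of_not_ge fun h => hcK.not_ge ?_
  rw [← ofReal_measureReal]
  exact ENNReal.ofReal_le_ofReal h

/-- The probability measure with weights `w` on a finite set `S`. -/
noncomputable def ofWeights (w : α → ℝ) (S : Finset α) (hw : ∀ b, 0 ≤ w b)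
    (h1 : ∑ b ∈ S, w b = 1) : ProbabilityMeasure α :=
  ⟨∑ b ∈ S, ENNReal.ofReal (w b) • Measure.dirac b, ⟨by
    simp [← ENNReal.ofReal_sum_of_nonneg fun b _ => hw b, h1]⟩⟩

variable {w : α → ℝ} {S : Finset α} (hw : ∀ b, 0 ≤ w b) (h1 : ∑ b ∈ S, w b = 1)

theorem ofWeights_compl : (ofWeights w S hw h1 : Measure α) (S : Set α)ᶜ = 0 := by
  simp only [ofWeights, ProbabilityMeasure.coe_mk, Measure.coe_finsetSum, Finset.sum_apply,
    Measure.smul_apply, smul_eq_mul, Finset.sum_eq_zero_iff]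
  intro b hb
  simp [hb]

theorem ofWeights_real_singleton (hS : ∀ b ∉ S, w b = 0) (b : α) :
    (ofWeights w S hw h1 : Measure α).real {b} = w b := by
  classical
  have : (ofWeights w S hw h1 : Measure α) {b} = ENNReal.ofReal (w b) := by
    simp only [ofWeights, ProbabilityMeasure.coe_mk, Measure.coe_finsetSum, Finset.sum_apply,
      Measure.smul_apply, smul_eq_mul, Measure.dirac_apply, Set.indicator_apply,
      Set.mem_singleton_iff]
    by_cases hb : b ∈ S
    · simp [hb]
    · simp [hb, hS b hb]
  rw [measureReal_def, this, ENNReal.toReal_ofReal (hw b)]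

theorem ofWeights_regular [TopologicalSpace α] [DiscreteTopology α] :
    (ofWeights w S hw h1 : Measure α).Regular where
  lt_top_of_isCompact _ _ := measure_lt_top _ _
  outerRegular A _ r hr := ⟨A, subset_rfl, isOpen_discrete A, hr⟩
  innerRegular := by
    intro U _ r hr
    refine ⟨U ∩ S, Set.inter_subset_left, (S.finite_toSet.inter_of_right U).isCompact, ?_⟩
    rwa [measure_inter_conull (ofWeights_compl hw h1)]

end Discrete

end TopGpd

/-! ### From amenability to compactly supported functions of positive type -/

namespace TopGpd

open GroupoidStr

section Algebra

variable {G : Type u} [GroupoidStr G]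

/-- The coefficient `a ↦ ⟨f, a f⟩ = ∑ f(b) f(a⁻¹ b)`, the sum being over `b` with `r b = r a`. -/
noncomputable def coefficient (f : G → ℝ) (a : G) : ℝ :=
  ∑ᶠ b : RFiber G (r a), f b.1 * f (ldiv a b.1)

theorem coefficient_ldiv (f : G → ℝ) {x : units (G := G)} {a c : G} (ha : r a = x)
    (hc : r c = x) :
    coefficient f (ldiv a c) = ∑ᶠ b : RFiber G x, f (ldiv a b.1) * f (ldiv c b.1) := by
  have hac : r a = r c := ha.trans hc.symm
  rw [coefficient, ← finsum_comp_equiv (ldivEquiv a ha (r_ldiv hac).symm)]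
  refine finsum_congr fun b => ?_
  change f (ldiv a b.1) * f (ldiv (ldiv a c) (ldiv a b.1)) = _
  rw [ldiv_ldiv hac (ha.trans b.2.symm)]

/-- Gram matrices of real vectors are positive semidefinite over `ℂ`. -/
theorem gram_nonneg {β : Type*} (S : Finset β) {n : ℕ} (f : Fin n → β → ℝ) (c : Fin n → ℂ) :
    0 ≤ ∑ i, ∑ j, conj (c i) * c j * ((∑ b ∈ S, f i b * f j b : ℝ) : ℂ) := by
  have : ∑ i, ∑ j, conj (c i) * c j * ((∑ b ∈ S, f i b * f j b : ℝ) : ℂ) =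
      ∑ b ∈ S, conj (∑ i, c i * f i b) * (∑ i, c i * f i b) := by
    simp_rw [map_sum, Finset.sum_mul_sum]
    rw [Finset.sum_comm]
    simp_rw [Complex.ofReal_sum, Finset.mul_sum]
    rw [Finset.sum_comm]
    simp_rw [Finset.sum_comm (t := S)]
    refine Finset.sum_congr rfl fun b _ => ?_
    refine Finset.sum_congr rfl fun i _ => Finset.sum_congr rfl fun j _ => ?_
    simp only [map_mul, Complex.conj_ofReal, Complex.ofReal_mul]
    ring
  rw [this]
  refine Finset.sum_nonneg fun b _ => ?_
  rw [mul_comm, Complex.mul_conj]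
  exact_mod_cast Complex.normSq_nonneg _

end Algebra

section Support

variable {G : Type u} [TopologicalSpace G] [GroupoidStr G] [IsEtaleGroupoid G]

theorem finite_support_rFiber {M : Type*} [Zero M] {f : G → M} (hfc : HasCompactSupport f)
    (x : units (G := G)) : (Function.support fun b : RFiber G x => f b.1).Finite :=
  finite_support_fiber isLocalHomeomorph_r (K := tsupport f) hfc
    fun _ _ he => image_eq_zero_of_notMem_tsupport he

theorem finite_support_ldiv {M : Type*} [Zero M] {f : G → M} (hfc : HasCompactSupport f)
    {x : units (G := G)} {a : G} (ha : r a = x) :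
    (Function.support fun b : RFiber G x => f (ldiv a b.1)).Finite :=
  (finite_support_rFiber hfc (s a)).preimage (f := ldivEquiv a ha rfl)
    (ldivEquiv a ha rfl).injective.injOn

end Support

section Coefficient

variable {G : Type u} [TopologicalSpace G] [GroupoidStr G] [IsEtaleGroupoid G] {f : G → ℝ}

theorem continuous_coefficient (hf : Continuous f) (hfc : HasCompactSupport f) :
    Continuous (coefficient f) := by
  refine continuous_finsum_fiber isLocalHomeomorph_r continuous_r (K := tsupport f) hfc
    (F := fun a b => f b * f (ldiv a b)) ?_
    fun a b _ hb => by simp [image_eq_zero_of_notMem_tsupport hb]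
  refine (hf.comp continuous_snd).continuousOn.mul (hf.comp_continuousOn ?_)
  exact ContinuousOn.ldiv continuous_fst.continuousOn continuous_snd.continuousOn
    fun z hz => Eq.symm hz

theorem hasCompactSupport_coefficient (hfc : HasCompactSupport f) :
    HasCompactSupport (coefficient f) := by
  refine HasCompactSupport.intro (isCompact_setOf_ldiv_mem' hfc hfc) fun a ha => ?_
  refine finsum_eq_zero_of_forall_eq_zero fun b => ?_
  by_contra hne
  exact ha ⟨b.1, subset_tsupport _ (left_ne_zero_of_mul hne), b.2.symm,
    subset_tsupport _ (right_ne_zero_of_mul hne)⟩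

/-- Coefficients are functions of positive type. -/
theorem isPositiveDefiniteKernel_coefficient (hfc : HasCompactSupport f) :
    IsPositiveDefiniteKernel fun q : RangePairs G => (coefficient f (invMul q) : ℂ) := by
  classical
  rw [isPositiveDefiniteKernel_comp_invMul_iff (h := fun a => (coefficient f a : ℂ))]
  intro x n a c
  set S : Finset (RFiber G x) := Finset.univ.biUnion fun i =>
    (finite_support_ldiv hfc (a i).2).toFinset
  have hS : ∀ i j, coefficient f (ldiv (a i).1 (a j).1) =
      ∑ b ∈ S, f (ldiv (a i).1 b.1) * f (ldiv (a j).1 b.1) := fun i j => by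
    rw [coefficient_ldiv f (a i).2 (a j).2]
    refine finsum_eq_sum_of_support_subset _ fun b hb => ?_
    simp only [S, Finset.coe_biUnion, Set.mem_iUnion]
    exact ⟨i, Finset.mem_univ _, by simpa using left_ne_zero_of_mul hb⟩
  simp_rw [hS]
  exact gram_nonneg S (fun i b => f (ldiv (a i).1 b.1)) c

end Coefficient

section Mass

variable {G : Type u} [GroupoidStr G] [MeasurableSpace G]
  (m : (x : units (G := G)) → ProbabilityMeasure (RFiber G x))

/-- The density of a family of measures on the range fibres with respect to the counting
measures. -/
noncomputable def mass (b : G) : ℝ :=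
  (m (r b) : Measure (RFiber G (r b))).real {⟨b, rfl⟩}

theorem mass_nonneg (b : G) : 0 ≤ mass m b := measureReal_nonneg

theorem mass_eq {x : units (G := G)} (b : RFiber G x) :
    mass m b.1 = (m x : Measure (RFiber G x)).real {b} := by
  obtain ⟨b, rfl⟩ := b; rfl

end Mass

section Amenable

variable {G : Type u} [TopologicalSpace G] [GroupoidStr G] [IsEtaleGroupoid G]
  [MeasurableSpace G] [BorelSpace G]
  (m : (x : units (G := G)) → ProbabilityMeasure (RFiber G x))

theorem sum_mass_le_one {x : units (G := G)} (S : Finset (RFiber G x)) :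
    ∑ b ∈ S, mass m b.1 ≤ 1 := by
  simp_rw [mass_eq, sum_measureReal_singleton]
  exact measureReal_le_one

/-- The density of a continuous family of measures is continuous. -/
theorem continuous_mass (hm : ∀ f : G → ℂ, Continuous f → HasCompactSupport f →
      Continuous fun x : units (G := G) =>
        ∫ a : RFiber G x, f a.1 ∂(m x : Measure (RFiber G x))) :
    Continuous (mass m) := by
  rw [continuous_iff_continuousAt]
  intro b₀
  obtain ⟨ψ, hψ, hψc, hψ1, -, hψi⟩ := exists_bump (isLocalHomeomorph_r (G := G)) b₀
  have hc := hm (fun a => (ψ a : ℂ)) (Complex.continuous_ofReal.comp hψ)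
    (hψc.comp_left (g := ((↑) : ℝ → ℂ)) Complex.ofReal_zero)
  refine (Complex.continuous_re.comp (hc.comp continuous_r)).continuousAt.congr ?_
  filter_upwards [hψ1] with b hb
  simp only [Function.comp_apply]
  rw [integral_eq_sum_of_support_subset (m (r b) : Measure (RFiber G (r b)))
    (S := {⟨b, rfl⟩}) (f := fun a : RFiber G (r b) => (ψ a.1 : ℂ))]
  · simp [hb, mass]
  · rintro ⟨a, ha⟩ hne
    by_contra h
    refine hne (Finset.mem_singleton.2 (Subtype.ext (hψi a b ?_ ?_ ha)))
    · exact_mod_cast h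
    · simp [hb]

/-- A continuous family of regular probability measures is tight over compact sets of units:
this is Dini's argument. -/
theorem exists_cutoff (hreg : ∀ x, (m x : Measure (RFiber G x)).Regular)
    (hm : Continuous (mass m)) {L : Set (units (G := G))} (hL : IsCompact L) {c : ℝ} (hc : c < 1) :
    ∃ ψ : G → ℝ, Continuous ψ ∧ HasCompactSupport ψ ∧ (∀ b, ψ b ∈ Set.Icc (0 : ℝ) 1) ∧
      ∀ x ∈ L, c < ∑ᶠ b : RFiber G x, ψ b.1 * mass m b.1 := by
  have hfin : ∀ {ψ : G → ℝ}, HasCompactSupport ψ → ∀ x : units (G := G),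
      (Function.support fun b : RFiber G x => ψ b.1 * mass m b.1).Finite := fun {ψ} hψ x =>
    (finite_support_rFiber hψ x).subset (Function.support_mul_subset_left _ _)
  have hle : ∀ {ψ φ : G → ℝ}, HasCompactSupport ψ → HasCompactSupport φ → (∀ b, ψ b ≤ φ b) →
      ∀ x : units (G := G), ∑ᶠ b : RFiber G x, ψ b.1 * mass m b.1 ≤
        ∑ᶠ b : RFiber G x, φ b.1 * mass m b.1 := fun hψ hφ h x => by
    exact finsum_le_finsum' (hfin hψ x) (hfin hφ x) fun b =>
      mul_le_mul_of_nonneg_right (h b.1) (mass_nonneg m b.1)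
  have hcont : ∀ {ψ : G → ℝ}, Continuous ψ → HasCompactSupport ψ →
      Continuous fun x : units (G := G) => ∑ᶠ b : RFiber G x, ψ b.1 * mass m b.1 := fun {ψ} h hψ =>
    continuous_finsum_fiber isLocalHomeomorph_r continuous_id (K := tsupport ψ) hψ
      (F := fun _ b => ψ b * mass m b) ((h.mul hm).comp continuous_snd).continuousOn
      fun _ e _ he => by simp [image_eq_zero_of_notMem_tsupport he]
  refine hL.induction_on ?_ ?_ ?_ ?_
  · exact ⟨0, continuous_const, HasCompactSupport.zero, by simp, by simp⟩
  · intro s t hst ht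
    obtain ⟨ψ, h1, h2, h3, h4⟩ := ht
    exact ⟨ψ, h1, h2, h3, fun x hx => h4 x (hst hx)⟩
  · intro s t hs ht
    obtain ⟨ψ, h1, h2, h3, h4⟩ := hs
    obtain ⟨φ, g1, g2, g3, g4⟩ := ht
    have hsupp : HasCompactSupport fun b => max (ψ b) (φ b) := by
      refine HasCompactSupport.intro (h2.isCompact.union g2.isCompact) fun b hb => ?_
      rw [Set.mem_union, not_or] at hb
      simp [image_eq_zero_of_notMem_tsupport hb.1, image_eq_zero_of_notMem_tsupport hb.2]
    refine ⟨fun b => max (ψ b) (φ b), h1.max g1, hsupp,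
      fun b => ⟨le_max_of_le_left (h3 b).1, max_le (h3 b).2 (g3 b).2⟩, ?_⟩
    rintro x (hx | hx)
    · exact (h4 x hx).trans_le (hle h2 hsupp (fun b => le_max_left _ _) x)
    · exact (g4 x hx).trans_le (hle g2 hsupp (fun b => le_max_right _ _) x)
  -- at a single unit it suffices that `ψ = 1` on a finite set of large mass
  · intro x hx
    obtain ⟨S, hS⟩ := exists_finset_lt_measureReal (m x) (hreg x) hc
    obtain ⟨ψ, h1, -, h2, h3⟩ := exists_continuous_one_zero_of_isCompact
      (S.finite_toSet.image Subtype.val).isCompact isClosed_empty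
      (Set.disjoint_empty (Subtype.val '' (S : Set (RFiber G x))))
    have hx : c < ∑ᶠ b : RFiber G x, ψ b.1 * mass m b.1 := by
      refine hS.trans_le ?_
      classical
      rw [finsum_eq_sum_of_support_subset (s := S ∪ (hfin h2 x).toFinset) _
        (fun b hb => by simpa using Or.inr hb)]
      refine le_trans (le_of_eq ?_) (Finset.sum_le_sum_of_subset_of_nonneg Finset.subset_union_left
        fun b _ _ => mul_nonneg (h3 _).1 (mass_nonneg m _))
      refine Finset.sum_congr rfl fun b hb => ?_
      rw [h1 (Set.mem_image_of_mem _ (Finset.mem_coe.2 hb)), ← mass_eq]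
      simp
    have ho := isOpen_lt (continuous_const (y := c)) (hcont ψ.continuous h2)
    exact ⟨_, mem_nhdsWithin_of_mem_nhds (ho.mem_nhds hx), ψ, ψ.continuous, h2, h3,
      fun y hy => hy⟩

theorem translate_real_singleton (a : G) (μ : ProbabilityMeasure (RFiber G (s a)))
    (b : RFiber G (r a)) :
    (translate a μ : Measure (RFiber G (r a))).real {b} =
      (μ : Measure (RFiber G (s a))).real {ldivEquiv a rfl rfl b} := by
  rw [measureReal_def, measureReal_def, translate, ProbabilityMeasure.toMeasure_map,
    Measure.map_apply (continuous_leftTranslation a).measurable (measurableSet_singleton b)]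
  congr 2
  rw [leftTranslation_eq]
  ext c
  simp [Equiv.symm_apply_eq]

/-- `√A √B` is bounded below by `min A B`; here `A ≤ t` and `B ≤ t'` are truncated masses. -/
theorem sub_le_sqrt_mul_sqrt {A B t t' : ℝ} (hA : 0 ≤ A) (hB : 0 ≤ B) (hAt : A ≤ t) (hBt : B ≤ t') :
    A - |t' - t| - (t' - B) ≤ √A * √B := by
  rcases le_total A B with h | h
  · have : A ≤ √A * √B := by
      nth_rewrite 1 [← Real.mul_self_sqrt hA]
      exact mul_le_mul_of_nonneg_left (Real.sqrt_le_sqrt h) (Real.sqrt_nonneg _)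
    linarith [abs_nonneg (t' - t)]
  · have : B ≤ √A * √B := by
      nth_rewrite 1 [← Real.mul_self_sqrt hB]
      exact mul_le_mul_of_nonneg_right (Real.sqrt_le_sqrt h) (Real.sqrt_nonneg _)
    linarith [neg_abs_le (t' - t)]

theorem sqrt_mul_sqrt_le {A B : ℝ} (hA : 0 ≤ A) (hB : 0 ≤ B) : √A * √B ≤ (A + B) / 2 := by
  nlinarith [sq_nonneg (√A - √B), Real.mul_self_sqrt hA, Real.mul_self_sqrt hB]

/-- If the measures are nearly concentrated on the truncation `ψ` and nearly invariant by `a`, the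
coefficient at `a` of the square root of their truncated density is nearly `1`. -/
theorem abs_coefficient_sub_one_le {ψ : G → ℝ} (hψc : HasCompactSupport ψ)
    (hψ : ∀ b, ψ b ∈ Set.Icc (0 : ℝ) 1) {a : G} {δ : ℝ}
    (hr : 1 - δ ≤ ∑ᶠ b : RFiber G (r a), ψ b.1 * mass m b.1)
    (hs : 1 - δ ≤ ∑ᶠ b : RFiber G (s a), ψ b.1 * mass m b.1)
    (hn : normDiff (translate a (m (s a))) (m (r a)) ≤ δ) :
    |coefficient (fun b => √(ψ b * mass m b)) a - 1| ≤ 3 * δ := by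
  classical
  have hδ : 0 ≤ δ := (normDiff_nonneg _ _).trans hn
  set t : RFiber G (r a) → ℝ := fun b => mass m b.1 with ht
  set t' : RFiber G (r a) → ℝ := fun b => mass m (ldiv a b.1) with ht'
  set A : RFiber G (r a) → ℝ := fun b => ψ b.1 * mass m b.1 with hA
  set B : RFiber G (r a) → ℝ := fun b => ψ (ldiv a b.1) * mass m (ldiv a b.1) with hB
  have fA : (Function.support fun b : RFiber G (r a) => ψ b.1).Finite :=
    finite_support_rFiber hψc _
  have fB := finite_support_ldiv hψc (a := a) rfl
  set S : Finset (RFiber G (r a)) := fA.toFinset ∪ fB.toFinset with hSdef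
  have sA : ∑ᶠ b, A b = ∑ b ∈ S, A b := finsum_eq_sum_of_support_subset _ fun b hb => by
    simpa [hSdef] using Or.inl (left_ne_zero_of_mul hb)
  have sB : ∑ᶠ b, B b = ∑ b ∈ S, B b := finsum_eq_sum_of_support_subset _ fun b hb => by
    simpa [hSdef] using Or.inr (left_ne_zero_of_mul hb)
  have sB' : ∑ᶠ b : RFiber G (s a), ψ b.1 * mass m b.1 = ∑ᶠ b, B b :=
    (finsum_comp_equiv (ldivEquiv a rfl rfl)).symm
  have sC : coefficient (fun b => √(ψ b * mass m b)) a = ∑ b ∈ S, √(A b) * √(B b) :=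
    finsum_eq_sum_of_support_subset _ fun b hb => by
      have : √(A b) ≠ 0 := left_ne_zero_of_mul hb
      have h2 : A b ≠ 0 := fun h => this (by rw [h, Real.sqrt_zero])
      simpa [hSdef] using Or.inl (left_ne_zero_of_mul h2)
  have ht1 : ∑ b ∈ S, t b ≤ 1 := sum_mass_le_one m S
  have ht1' : ∑ b ∈ S, t' b ≤ 1 := by
    have := sum_mass_le_one m (S.map (ldivEquiv a rfl rfl).toEmbedding)
    rwa [Finset.sum_map] at this
  -- the points `b` and `a⁻¹ b` are compared, so near invariance bounds the difference of masses
  have hd : ∑ b ∈ S, |t' b - t b| ≤ δ := by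
    refine le_trans (le_of_eq ?_) ((sum_abs_sub_le_normDiff _ _ S).trans hn)
    refine Finset.sum_congr rfl fun b _ => ?_
    rw [translate_real_singleton, ← mass_eq, ← mass_eq]
    rfl
  have hA0 : ∀ b, 0 ≤ A b := fun b => mul_nonneg (hψ _).1 (mass_nonneg m _)
  have hB0 : ∀ b, 0 ≤ B b := fun b => mul_nonneg (hψ _).1 (mass_nonneg m _)
  have hAt : ∀ b, A b ≤ t b := fun b => mul_le_of_le_one_left (mass_nonneg m _) (hψ _).2
  have hBt : ∀ b, B b ≤ t' b := fun b => mul_le_of_le_one_left (mass_nonneg m _) (hψ _).2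
  have hlow : ∑ b ∈ S, (A b - |t' b - t b| - (t' b - B b)) ≤ ∑ b ∈ S, √(A b) * √(B b) :=
    Finset.sum_le_sum fun b _ => sub_le_sqrt_mul_sqrt (hA0 b) (hB0 b) (hAt b) (hBt b)
  have hup : ∑ b ∈ S, √(A b) * √(B b) ≤ ∑ b ∈ S, (A b + B b) / 2 :=
    Finset.sum_le_sum fun b _ => sqrt_mul_sqrt_le (hA0 b) (hB0 b)
  have hA1 : ∑ b ∈ S, A b ≤ 1 := (Finset.sum_le_sum fun b _ => hAt b).trans ht1
  have hB1 : ∑ b ∈ S, B b ≤ 1 := (Finset.sum_le_sum fun b _ => hBt b).trans ht1'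
  rw [Finset.sum_sub_distrib, Finset.sum_sub_distrib, Finset.sum_sub_distrib] at hlow
  rw [← Finset.sum_div, Finset.sum_add_distrib] at hup
  rw [sA] at hr
  rw [sB', sB] at hs
  rw [sC, abs_le]
  constructor <;> linarith

/-- On an amenable étale groupoid there are compactly supported functions of positive type which
are uniformly close to `1` on a given compact set. -/
theorem IsAmenable.exists_positive_type (hG : IsAmenable G) {K : Set G} (hK : IsCompact K) {ε : ℝ}
    (hε : 0 < ε) :
    ∃ h : G → ℂ, Continuous h ∧ HasCompactSupport h ∧
      IsPositiveDefiniteKernel (fun q : RangePairs G => h (invMul q)) ∧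
      ∀ a ∈ K, ‖h a - 1‖ ≤ ε := by
  obtain ⟨I, _, _, _, m, hreg, hcont, hinv⟩ := hG
  -- a third of `ε`, since the coefficient at `a` is within `3 δ` of `1`
  have hδ : 0 < ε / 3 := by positivity
  obtain ⟨i, hi⟩ := (Metric.tendstoUniformlyOn_iff.1 (hinv K hK) (ε / 3) hδ).exists
  have hm := continuous_mass (m i) (hcont i)
  obtain ⟨ψ, hψ, hψc, hψ1, hψK⟩ := exists_cutoff (m i) (hreg i) hm
    ((hK.image continuous_r).union (hK.image continuous_s)) (c := 1 - ε / 3) (by linarith)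
  set f : G → ℝ := fun b => √(ψ b * mass (m i) b) with hf
  have hfcont : Continuous f := (hψ.mul hm).sqrt
  have hfc : HasCompactSupport f := HasCompactSupport.intro hψc fun b hb => by
    simp [hf, image_eq_zero_of_notMem_tsupport hb]
  refine ⟨fun a => (coefficient f a : ℂ),
    Complex.continuous_ofReal.comp (continuous_coefficient hfcont hfc),
    (hasCompactSupport_coefficient hfc).comp_left (g := ((↑) : ℝ → ℂ)) Complex.ofReal_zero,
    isPositiveDefiniteKernel_coefficient hfc, fun a ha => ?_⟩
  have := abs_coefficient_sub_one_le (m i) hψc hψ1 (a := a) (δ := ε / 3)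
    (hψK _ (Or.inl ⟨a, ha, rfl⟩)).le (hψK _ (Or.inr ⟨a, ha, rfl⟩)).le
    (by have := hi a ha
        rw [Real.dist_eq, zero_sub, abs_neg] at this
        exact (le_abs_self _).trans this.le)
  rw [← Complex.ofReal_one, ← Complex.ofReal_sub, Complex.norm_real, Real.norm_eq_abs]
  linarith

end Amenable

end TopGpd

/-! ### Polynomials in positive semidefinite matrices -/

namespace TopGpd

section Matrix

open Matrix Polynomial

variable {n : Type*} [Fintype n] [DecidableEq n] {A : Matrix n n ℂ}

/-- The spectral theorem for polynomials in a Hermitian matrix. -/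
theorem aeval_eq_conj_diagonal (hA : A.IsHermitian) (Q : ℝ[X]) :
    aeval A Q = (hA.eigenvectorUnitary : Matrix n n ℂ) *
      diagonal (fun k => ((Q.eval (hA.eigenvalues k) : ℝ) : ℂ)) *
        star (hA.eigenvectorUnitary : Matrix n n ℂ) := by
  set φ := Unitary.conjStarAlgAut ℝ (Matrix n n ℂ) hA.eigenvectorUnitary
  have h : A = φ (diagonal (fun k => (hA.eigenvalues k : ℂ))) := hA.spectral_theorem
  have hd : aeval (diagonal (fun k => (hA.eigenvalues k : ℂ))) Q =
      diagonal (fun k => ((Q.eval (hA.eigenvalues k) : ℝ) : ℂ)) := by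
    have := aeval_algHom_apply (diagonalAlgHom ℝ (n := n) (α := ℂ))
      (fun k => (hA.eigenvalues k : ℂ)) Q
    rw [diagonalAlgHom_apply, diagonalAlgHom_apply] at this
    rw [this, aeval_pi_apply]
    congr 1
    ext k
    exact (aeval_algebraMap_apply ℂ (hA.eigenvalues k) Q).trans (by
      rw [coe_aeval_eq_eval]; rfl)
  have h2 : aeval A Q = φ (aeval (diagonal (fun k => (hA.eigenvalues k : ℂ))) Q) := by
    conv_lhs => rw [h]
    exact aeval_algHom_apply (φ : Matrix n n ℂ →ₐ[ℝ] Matrix n n ℂ) _ Q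
  rw [h2, hd]
  rfl

theorem conjTranspose_aeval (hA : A.IsHermitian) (Q : ℝ[X]) : (aeval A Q)ᴴ = aeval A Q := by
  have hd : (diagonal (fun k => ((Q.eval (hA.eigenvalues k) : ℝ) : ℂ)))ᴴ =
      diagonal (fun k => ((Q.eval (hA.eigenvalues k) : ℝ) : ℂ)) := by
    rw [diagonal_conjTranspose]
    congr 1
    ext k
    simp
  have key : ∀ V D : Matrix n n ℂ, Dᴴ = D → (V * D * star V)ᴴ = V * D * star V := by
    intro V D h
    rw [star_eq_conjTranspose, conjTranspose_mul, conjTranspose_mul, h,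
      conjTranspose_conjTranspose, Matrix.mul_assoc]
  rw [aeval_eq_conj_diagonal hA Q]
  exact key _ _ hd

/-- The entries of `Q(A)` are bounded by the supremum of `|Q|` on the eigenvalues of `A`. -/
theorem norm_aeval_apply_le (hA : A.IsHermitian) {Q : ℝ[X]} {ε : ℝ}
    (hQ : ∀ k, |Q.eval (hA.eigenvalues k)| ≤ ε) (i j : n) : ‖aeval A Q i j‖ ≤ ε := by
  set U := (hA.eigenvectorUnitary : Matrix n n ℂ) with hU
  have hrow : ∀ i, ∑ k, ‖U i k‖ ^ 2 = 1 := fun i => by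
    have h1 : (U * star U) i i = 1 := by
      rw [show U * star U = 1 from (Unitary.mem_iff.1 hA.eigenvectorUnitary.2).2,
        Matrix.one_apply_eq]
    rw [mul_apply] at h1
    have : ∑ k, U i k * star U k i = ((∑ k, ‖U i k‖ ^ 2 : ℝ) : ℂ) := by
      push_cast
      refine Finset.sum_congr rfl fun k _ => ?_
      rw [star_apply, Complex.star_def, Complex.mul_conj']
    rw [this] at h1
    exact_mod_cast h1
  have hε : 0 ≤ ε := (abs_nonneg _).trans (hQ i)
  rw [aeval_eq_conj_diagonal hA Q, mul_apply]
  calc ‖∑ k, (U * diagonal fun k => ((Q.eval (hA.eigenvalues k) : ℝ) : ℂ)) i k * star U k j‖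
      ≤ ∑ k, ε * ((‖U i k‖ ^ 2 + ‖U j k‖ ^ 2) / 2) := by
        refine (norm_sum_le _ _).trans (Finset.sum_le_sum fun k _ => ?_)
        rw [mul_diagonal, norm_mul, norm_mul, star_apply, norm_star, Complex.norm_real,
          Real.norm_eq_abs]
        have h1 := two_mul_le_add_sq ‖U i k‖ ‖U j k‖
        have h2 : ‖U i k‖ * ‖U j k‖ ≤ (‖U i k‖ ^ 2 + ‖U j k‖ ^ 2) / 2 := by linarith
        calc _ = |Q.eval (hA.eigenvalues k)| * (‖U i k‖ * ‖U j k‖) := by ring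
          _ ≤ _ := mul_le_mul (hQ k) h2 (by positivity) hε
    _ = ε := by
        rw [← Finset.mul_sum, ← Finset.sum_div, Finset.sum_add_distrib, hrow, hrow]; ring

/-- The eigenvalues of a matrix are bounded by the absolute row sums. -/
theorem eigenvalues_le_of_row_sum_le (hA : A.IsHermitian) {M : ℝ} (hM : ∀ i, ∑ j, ‖A i j‖ ≤ M)
    (k : n) : hA.eigenvalues k ≤ M := by
  have h1 : (hA.eigenvalues k : ℂ) ∈ spectrum ℂ A := by
    have := hA.eigenvalues_mem_spectrum_real k
    rwa [← spectrum.algebraMap_mem_iff ℂ] at this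
  have h2 : Module.End.HasEigenvalue (toLin' A) (hA.eigenvalues k : ℂ) := by
    rw [Module.End.hasEigenvalue_iff_mem_spectrum, spectrum_toLin']; exact h1
  obtain ⟨i, hi⟩ := eigenvalue_mem_ball h2
  rw [mem_closedBall_iff_norm] at hi
  have h3 := Finset.add_sum_erase Finset.univ (fun j => ‖A i j‖) (Finset.mem_univ i)
  have h4 := norm_sub_norm_le (hA.eigenvalues k : ℂ) (A i i)
  rw [Complex.norm_real, Real.norm_eq_abs] at h4
  linarith [le_abs_self (hA.eigenvalues k), hM i]

/-- If `P²` is close to the identity function on an interval which contains the eigenvalues of the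
positive semidefinite matrix `A`, then `P(A) P(A)ᴴ` is close to `A` entrywise. -/
theorem norm_aeval_mul_conjTranspose_sub_le (hA : A.PosSemidef) {M : ℝ}
    (hM : ∀ i, ∑ j, ‖A i j‖ ≤ M) {P : ℝ[X]} {ε : ℝ}
    (hP : ∀ t ∈ Set.Icc 0 M, |P.eval t * P.eval t - t| ≤ ε) (i j : n) :
    ‖(aeval A P * (aeval A P)ᴴ) i j - A i j‖ ≤ ε := by
  have h : aeval A P * (aeval A P)ᴴ - A = aeval A (P * P - X) := by
    rw [conjTranspose_aeval hA.1, map_sub, map_mul, aeval_X]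
  rw [← Matrix.sub_apply, h]
  refine norm_aeval_apply_le hA.1 (fun k => ?_) i j
  rw [eval_sub, eval_mul, eval_X]
  exact hP _ ⟨hA.eigenvalues_nonneg k, eigenvalues_le_of_row_sum_le hA.1 hM k⟩

/-- A polynomial without constant term whose square approximates the identity function of
`[0, M]`. -/
theorem exists_polynomial_sq_near (M : ℝ) {ε : ℝ} (hε : 0 < ε) :
    ∃ P : ℝ[X], ∀ t ∈ Set.Icc 0 M, |(X * P).eval t * (X * P).eval t - t| ≤ ε := by
  -- an error `δ` in the approximation of `√t` gives an error at most `δ (δ + 2 √M)` in the square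
  obtain ⟨δ, hδ, hδε⟩ : ∃ δ : ℝ, 0 < δ ∧ 2 * δ * (2 * δ + 2 * √M) ≤ ε := by
    refine ⟨min 1 (ε / (2 * (2 + 2 * √M))), by positivity, ?_⟩
    set δ := min 1 (ε / (2 * (2 + 2 * √M)))
    have h1 : δ ≤ 1 := min_le_left _ _
    have h2 : δ ≤ ε / (2 * (2 + 2 * √M)) := min_le_right _ _
    rw [le_div_iff₀ (by positivity)] at h2
    have h0 : 0 < δ := by positivity
    nlinarith [Real.sqrt_nonneg M]
  obtain ⟨Q, hQ⟩ := exists_polynomial_near_of_continuousOn 0 M Real.sqrt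
    Real.continuous_sqrt.continuousOn δ hδ
  -- drop the constant term, which is small since `√0 = 0`
  refine ⟨Q.divX, fun t ht => ?_⟩
  have h0 : |Q.coeff 0| < δ := by
    have := hQ 0 ⟨le_rfl, ht.1.trans ht.2⟩
    rwa [Real.sqrt_zero, sub_zero, ← coeff_zero_eq_eval_zero] at this
  have hX : (X * Q.divX).eval t = Q.eval t - Q.coeff 0 := by
    have := congrArg (eval t) Q.X_mul_divX_add
    rw [eval_add, eval_C] at this
    linarith
  have hd : |(X * Q.divX).eval t - √t| ≤ 2 * δ := by
    rw [hX]
    have := abs_sub (Q.eval t - √t) (Q.coeff 0)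
    rw [show Q.eval t - Q.coeff 0 - √t = Q.eval t - √t - Q.coeff 0 by ring]
    linarith [hQ t ht]
  set p := (X * Q.divX).eval t
  have hs : √t ≤ √M := Real.sqrt_le_sqrt ht.2
  have hf : p * p - t = (p - √t) * ((p - √t) + 2 * √t) := by
    nlinarith [Real.mul_self_sqrt ht.1]
  rw [hf, abs_mul]
  have hb : |(p - √t) + 2 * √t| ≤ 2 * δ + 2 * √M := by
    refine (abs_add_le _ _).trans ?_
    rw [abs_of_nonneg (a := 2 * √t) (by positivity)]
    linarith
  exact (mul_le_mul hd hb (abs_nonneg _) (by positivity)).trans hδε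

end Matrix

end TopGpd

/-! ### Square roots of functions of positive type -/

namespace TopGpd

open GroupoidStr

section Convolution

variable {G : Type u} [GroupoidStr G]

/-- The convolution `(f * g)(a) = ∑ f(b) g(b⁻¹ a)`, the sum being over `b` with `r b = r a`. -/
noncomputable def conv (f g : G → ℂ) (a : G) : ℂ :=
  ∑ᶠ b : RFiber G (r a), f b.1 * g (ldiv b.1 a)

theorem conv_ldiv (f g : G → ℂ) {x : units (G := G)} {a c : G} (ha : r a = x) (hc : r c = x) :
    conv f g (ldiv a c) = ∑ᶠ b : RFiber G x, f (ldiv a b.1) * g (ldiv b.1 c) := by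
  have hac : r a = r c := ha.trans hc.symm
  rw [conv, ← finsum_comp_equiv (ldivEquiv a ha (r_ldiv hac).symm)]
  refine finsum_congr fun b => ?_
  change f (ldiv a b.1) * g (ldiv (ldiv a b.1) (ldiv a c)) = _
  rw [ldiv_ldiv (ha.trans b.2.symm) hac]

/-- The convolution power of exponent `n + 1`. -/
noncomputable def convPow (h : G → ℂ) : ℕ → G → ℂ
  | 0 => h
  | n + 1 => conv h (convPow h n)

/-- The value at `h` of the polynomial `X Q`, in the convolution algebra. -/
noncomputable def convPoly (h : G → ℂ) (Q : Polynomial ℝ) (a : G) : ℂ :=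
  ∑ n ∈ Q.support, Q.coeff n • convPow h n a

/-- The finite matrix `(h (a⁻¹ b))`, where `a` and `b` run through the subset `S` of a range
fibre. -/
noncomputable def kernelMatrix (h : G → ℂ) {x : units (G := G)} (S : Finset (RFiber G x)) :
    Matrix S S ℂ := fun a b => h (ldiv a.1.1 b.1.1)

/-- A positive definite kernel is Hermitian. -/
theorem conj_eq_of_isPositiveDefiniteKernel {h : G → ℂ}
    (hp : IsPositiveDefiniteKernel fun q : RangePairs G => h (invMul q)) {x : units (G := G)}
    (a b : RFiber G x) : conj (h (ldiv a.1 b.1)) = h (ldiv b.1 a.1) := by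
  rw [isPositiveDefiniteKernel_comp_invMul_iff] at hp
  have key : ∀ c d : ℂ, (conj c * c * h (ldiv a.1 a.1) + conj c * d * h (ldiv a.1 b.1)
      + (conj d * c * h (ldiv b.1 a.1) + conj d * d * h (ldiv b.1 b.1))).im = 0 := fun c d => by
    have := hp x 2 ![a, b] ![c, d]
    simp only [Fin.sum_univ_two, Matrix.cons_val_zero, Matrix.cons_val_one] at this
    exact (Complex.le_def.1 this).2.symm
  -- polarization
  have k1 := key 1 0
  have k2 := key 0 1
  have k3 := key 1 1
  have k4 := key 1 Complex.I
  simp only [map_one, map_zero, one_mul, zero_mul, mul_one, mul_zero, add_zero, zero_add,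
    Complex.add_im, Complex.conj_I, Complex.mul_im, Complex.mul_re, Complex.neg_re, Complex.neg_im,
    Complex.I_re, Complex.I_im] at k1 k2 k3 k4
  refine Complex.ext ?_ ?_
  · rw [Complex.conj_re]; linarith
  · rw [Complex.conj_im]; linarith

theorem posSemidef_kernelMatrix {h : G → ℂ}
    (hp : IsPositiveDefiniteKernel fun q : RangePairs G => h (invMul q)) {x : units (G := G)}
    (S : Finset (RFiber G x)) : (kernelMatrix h S).PosSemidef := by
  refine Matrix.PosSemidef.of_dotProduct_mulVec_nonneg ?_ fun c => ?_
  · ext a b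
    exact conj_eq_of_isPositiveDefiniteKernel hp b.1 a.1
  · rw [isPositiveDefiniteKernel_comp_invMul_iff] at hp
    refine (hp x S.card (fun i => (S.equivFin.symm i).1) fun i => c (S.equivFin.symm i)).trans_eq ?_
    simp only [dotProduct, Matrix.mulVec, Finset.mul_sum, Pi.star_apply]
    refine (Equiv.sum_comp S.equivFin.symm (fun a : S => ∑ i : Fin S.card,
      conj (c a) * c (S.equivFin.symm i) * h (ldiv a.1.1 (S.equivFin.symm i).1.1))).trans ?_
    refine Finset.sum_congr rfl fun a _ => ?_
    refine (Equiv.sum_comp S.equivFin.symm (fun b : S =>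
      conj (c a) * c b * h (ldiv a.1.1 b.1.1))).trans ?_
    refine Finset.sum_congr rfl fun b _ => ?_
    change _ = conj (c a) * (h (ldiv a.1.1 b.1.1) * c b)
    ring

end Convolution

section Etale

variable {G : Type u} [TopologicalSpace G] [GroupoidStr G] [IsEtaleGroupoid G] {f g h : G → ℂ}

theorem continuous_conv (hf : Continuous f) (hfc : HasCompactSupport f) (hg : Continuous g) :
    Continuous (conv f g) := by
  refine continuous_finsum_fiber isLocalHomeomorph_r continuous_r (K := tsupport f) hfc
    (F := fun a b => f b * g (ldiv b a)) ?_
    fun a b _ hb => by simp [image_eq_zero_of_notMem_tsupport hb]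
  refine (hf.comp continuous_snd).continuousOn.mul (hg.comp_continuousOn ?_)
  exact ContinuousOn.ldiv continuous_snd.continuousOn continuous_fst.continuousOn fun z hz => hz

theorem hasCompactSupport_conv (hfc : HasCompactSupport f) (hgc : HasCompactSupport g) :
    HasCompactSupport (conv f g) := by
  refine HasCompactSupport.intro (isCompact_setOf_ldiv_mem hfc hgc) fun a ha => ?_
  refine finsum_eq_zero_of_forall_eq_zero fun b => ?_
  by_contra hne
  exact ha ⟨b.1, subset_tsupport _ (left_ne_zero_of_mul hne), b.2,
    subset_tsupport _ (right_ne_zero_of_mul hne)⟩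

theorem convPow_spec (hh : Continuous h) (hc : HasCompactSupport h) :
    ∀ n, Continuous (convPow h n) ∧ HasCompactSupport (convPow h n)
  | 0 => ⟨hh, hc⟩
  | n + 1 => ⟨continuous_conv hh hc (convPow_spec hh hc n).1,
      hasCompactSupport_conv hc (convPow_spec hh hc n).2⟩

theorem continuous_convPoly (hh : Continuous h) (hc : HasCompactSupport h) (Q : Polynomial ℝ) :
    Continuous (convPoly h Q) :=
  continuous_finsetSum _ fun n _ => (convPow_spec hh hc n).1.const_smul (Q.coeff n)

theorem hasCompactSupport_convPoly (hh : Continuous h) (hc : HasCompactSupport h)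
    (Q : Polynomial ℝ) : HasCompactSupport (convPoly h Q) := by
  refine HasCompactSupport.intro (Q.support.finite_toSet.isCompact_biUnion
    fun n _ => (convPow_spec hh hc n).2.isCompact) fun a ha => ?_
  refine Finset.sum_eq_zero fun n hn => ?_
  have : a ∉ tsupport (convPow h n) := fun h' => ha (Set.mem_biUnion (Finset.mem_coe.2 hn) h')
  rw [image_eq_zero_of_notMem_tsupport this, smul_zero]

open scoped Classical in
/-- Powers of large enough finite sections of the convolution operator of `h` are given by
convolution powers: the operator has finite propagation. -/
theorem eventually_kernelMatrix_pow (hc : HasCompactSupport h) {x : units (G := G)} (n : ℕ) :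
    ∀ a : RFiber G x, ∀ᶠ S : Finset (RFiber G x) in atTop, ∀ (ha : a ∈ S) (b : S),
      (kernelMatrix h S ^ (n + 1)) ⟨a, ha⟩ b = convPow h n (ldiv a.1 b.1.1) := by
  induction n with
  | zero =>
    intro a
    refine Eventually.of_forall fun S ha b => ?_
    rw [zero_add, pow_one]
    rfl
  | succ n ih =>
    intro a
    have hT := finite_support_ldiv hc a.2
    -- row `a` of the next power only involves the rows at the finitely many `c` with
    -- `h (a⁻¹ c) ≠ 0`
    have h1 := (Filter.eventually_all_finset hT.toFinset).2 fun c _ => ih c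
    filter_upwards [h1, eventually_ge_atTop hT.toFinset] with S h1 h2 ha b
    rw [pow_succ', Matrix.mul_apply]
    have hsum : conv h (convPow h n) (ldiv a.1 b.1.1) =
        ∑ c ∈ S, h (ldiv a.1 c.1) * convPow h n (ldiv c.1 b.1.1) := by
      rw [conv_ldiv _ _ a.2 b.1.2]
      refine finsum_eq_sum_of_support_subset _ fun c hcne => h2 ?_
      simpa using left_ne_zero_of_mul hcne
    refine Eq.trans ?_ hsum.symm
    rw [← Finset.sum_coe_sort S]
    refine Finset.sum_congr rfl fun c _ => ?_
    by_cases hz : h (ldiv a.1 c.1.1) = 0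
    · rw [hz, zero_mul, kernelMatrix, hz, zero_mul]
    · rw [h1 c.1 (by simpa using hz) c.2 b]
      rfl

open scoped Classical in
/-- Polynomials without constant term in large finite sections are given by `convPoly`. -/
theorem eventually_aeval_kernelMatrix (hc : HasCompactSupport h) (Q : Polynomial ℝ)
    {x : units (G := G)} (a : RFiber G x) :
    ∀ᶠ S : Finset (RFiber G x) in atTop, ∀ (ha : a ∈ S) (b : S),
      Polynomial.aeval (kernelMatrix h S) (Polynomial.X * Q) ⟨a, ha⟩ b =
        convPoly h Q (ldiv a.1 b.1.1) := by
  filter_upwards [(Filter.eventually_all_finset Q.support).2 fun n _ =>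
    eventually_kernelMatrix_pow hc n a] with S hS ha b
  rw [map_mul, Polynomial.aeval_X, Polynomial.aeval_eq_sum_range' (n := Q.natDegree + 1) (by simp),
    Finset.mul_sum, Matrix.sum_apply, convPoly]
  have hsub : Q.support ⊆ Finset.range (Q.natDegree + 1) :=
    Polynomial.supp_subset_range_natDegree_succ
  rw [← Finset.sum_subset hsub]
  · refine Finset.sum_congr rfl fun n hn => ?_
    rw [mul_smul_comm, ← pow_succ', Matrix.smul_apply, hS n hn ha b]
  · intro n _ hn
    rw [Polynomial.notMem_support_iff.1 hn, zero_smul, mul_zero, Matrix.zero_apply]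

/-- The convolution operators of `h` on the range fibres have uniformly bounded `ℓ^∞` norms. -/
theorem exists_row_sum_bound (hh : Continuous h) (hc : HasCompactSupport h) :
    ∃ M : ℝ, ∀ (x : units (G := G)) (a : RFiber G x) (S : Finset (RFiber G x)),
      ∑ b ∈ S, ‖h (ldiv a.1 b.1)‖ ≤ M := by
  have hn : HasCompactSupport fun a => ‖h a‖ := hc.norm
  have hcont : Continuous fun x : units (G := G) => ∑ᶠ b : RFiber G x, ‖h b.1‖ :=
    continuous_finsum_fiber isLocalHomeomorph_r continuous_id (K := tsupport h) hc
      (F := fun _ b => ‖h b‖) (hh.norm.comp continuous_snd).continuousOn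
      fun _ e _ he => by simp [image_eq_zero_of_notMem_tsupport he]
  have hsupp : HasCompactSupport fun x : units (G := G) => ∑ᶠ b : RFiber G x, ‖h b.1‖ := by
    refine HasCompactSupport.intro (hc.isCompact.image continuous_r) fun x hx => ?_
    refine finsum_eq_zero_of_forall_eq_zero fun b => ?_
    rw [image_eq_zero_of_notMem_tsupport fun hb => hx ⟨b.1, hb, b.2⟩, norm_zero]
  obtain ⟨M, hM⟩ := hcont.bounded_above_of_compact_support hsupp
  refine ⟨M, fun x a S => ?_⟩
  classical
  have hfin := finite_support_ldiv hn a.2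
  calc ∑ b ∈ S, ‖h (ldiv a.1 b.1)‖
      ≤ ∑ b ∈ S ∪ hfin.toFinset, ‖h (ldiv a.1 b.1)‖ :=
        Finset.sum_le_sum_of_subset_of_nonneg Finset.subset_union_left fun _ _ _ => norm_nonneg _
    _ = ∑ᶠ b : RFiber G x, ‖h (ldiv a.1 b.1)‖ :=
        (finsum_eq_sum_of_support_subset _ fun b hb => by simpa using Or.inr hb).symm
    _ = ∑ᶠ b : RFiber G (s a.1), ‖h b.1‖ :=
        finsum_comp_equiv (ldivEquiv a.1 a.2 rfl) (f := fun b : RFiber G (s a.1) => ‖h b.1‖)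
    _ ≤ M := (le_abs_self _).trans (hM (s a.1))

/-- A compactly supported function of positive type is uniformly close to a coefficient of the
regular representation, given by a compactly supported function. -/
theorem exists_approx_sqrt (hh : Continuous h) (hc : HasCompactSupport h)
    (hp : IsPositiveDefiniteKernel fun q : RangePairs G => h (invMul q)) {ε : ℝ} (hε : 0 < ε) :
    ∃ f : G → ℂ, Continuous f ∧ HasCompactSupport f ∧
      ∀ (x : units (G := G)) (a a' : RFiber G x), ∀ᶠ S : Finset (RFiber G x) in atTop,
        ‖∑ b ∈ S, f (ldiv a.1 b.1) * conj (f (ldiv a'.1 b.1)) - h (ldiv a.1 a'.1)‖ ≤ ε := by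
  classical
  obtain ⟨M, hM⟩ := exists_row_sum_bound hh hc
  obtain ⟨P, hP⟩ := exists_polynomial_sq_near M hε
  refine ⟨convPoly h P, continuous_convPoly hh hc P, hasCompactSupport_convPoly hh hc P,
    fun x a a' => ?_⟩
  filter_upwards [eventually_aeval_kernelMatrix hc P a, eventually_aeval_kernelMatrix hc P a',
    eventually_ge_atTop {a}, eventually_ge_atTop {a'}] with S h1 h2 ha ha'
  rw [Finset.singleton_subset_iff] at ha ha'
  have h3 := norm_aeval_mul_conjTranspose_sub_le (posSemidef_kernelMatrix hp S) (M := M)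
    (fun i => by
      have := hM x i.1 S
      rwa [← Finset.sum_coe_sort S] at this) hP ⟨a, ha⟩ ⟨a', ha'⟩
  rw [Matrix.mul_apply] at h3
  refine le_trans (le_of_eq ?_) h3
  congr 2
  rw [← Finset.sum_coe_sort S]
  refine Finset.sum_congr rfl fun b _ => ?_
  rw [Matrix.conjTranspose_apply, h1 ha b, h2 ha' b]
  rfl

end Etale

end TopGpd

/-! ### From functions of positive type to amenability -/

namespace TopGpd

open GroupoidStr TopologicalSpace

/-- Uniform convergence to `c` on the preimages of compact sets, for a family indexed by pairs of a
compact set and a natural number which achieves there the precision `1 / (n + 1)`. -/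
theorem tendstoUniformlyOn_of_compacts {G α β : Type*} [TopologicalSpace G] [PseudoMetricSpace β]
    {F : Compacts G × ℕ → α → β} {c : β} {φ : α → G}
    (hF : ∀ i a, φ a ∈ i.1 → dist c (F i a) ≤ 1 / ((i.2 : ℝ) + 1)) {K : Set G} (hK : IsCompact K)
    {T : Set α} (hT : ∀ a ∈ T, φ a ∈ K) : TendstoUniformlyOn F (fun _ => c) atTop T := by
  rw [Metric.tendstoUniformlyOn_iff]
  intro ε hε
  obtain ⟨n, hn⟩ := exists_nat_one_div_lt hε
  filter_upwards [eventually_ge_atTop ((⟨K, hK⟩, n) : Compacts G × ℕ)] with i hi a ha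
  refine (hF i a (hi.1 (hT a ha))).trans_lt (lt_of_le_of_lt ?_ hn)
  have : (n : ℝ) ≤ i.2 := by exact_mod_cast hi.2
  exact one_div_le_one_div_of_le (by positivity) (by linarith)

/-- Two vectors which are nearly of norm one and nearly equal have close squared moduli in `ℓ¹`. -/
theorem sum_abs_sq_sub_sq_le {β : Type*} (S : Finset β) (p q : β → ℂ) {t : ℝ} (ht : 0 < t) :
    ∑ b ∈ S, |‖p b‖ ^ 2 - ‖q b‖ ^ 2| ≤
      (∑ b ∈ S, ‖p b‖ ^ 2 + ∑ b ∈ S, ‖q b‖ ^ 2 - 2 * (∑ b ∈ S, p b * conj (q b)).re) / (2 * t)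
        + t * (∑ b ∈ S, ‖p b‖ ^ 2 + ∑ b ∈ S, ‖q b‖ ^ 2) := by
  rw [Complex.re_sum, Finset.mul_sum, ← Finset.sum_add_distrib, ← Finset.sum_sub_distrib,
    Finset.sum_div, Finset.mul_sum, ← Finset.sum_add_distrib]
  refine Finset.sum_le_sum fun b _ => ?_
  have h1 : ‖p b - q b‖ ^ 2 = ‖p b‖ ^ 2 + ‖q b‖ ^ 2 - 2 * (p b * conj (q b)).re := by
    rw [← Complex.normSq_eq_norm_sq, ← Complex.normSq_eq_norm_sq, ← Complex.normSq_eq_norm_sq,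
      Complex.normSq_sub]
  rw [← h1]
  have h2 : |‖p b‖ - ‖q b‖| ≤ ‖p b - q b‖ := abs_norm_sub_norm_le _ _
  set d := ‖p b - q b‖
  have h3 : |‖p b‖ ^ 2 - ‖q b‖ ^ 2| = |‖p b‖ - ‖q b‖| * (‖p b‖ + ‖q b‖) := by
    rw [sq_sub_sq, abs_mul, abs_of_nonneg (a := ‖p b‖ + ‖q b‖) (by positivity), mul_comm]
  rw [h3]
  have h4 : d ^ 2 / (2 * t) + t * (‖p b‖ ^ 2 + ‖q b‖ ^ 2) - d * (‖p b‖ + ‖q b‖)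
      = (d / t - (‖p b‖ + ‖q b‖)) ^ 2 * t / 2 + t * (‖p b‖ - ‖q b‖) ^ 2 / 2 := by
    field_simp
    ring
  have h5 : 0 ≤ (d / t - (‖p b‖ + ‖q b‖)) ^ 2 * t / 2 + t * (‖p b‖ - ‖q b‖) ^ 2 / 2 := by
    positivity
  have h6 := mul_le_mul_of_nonneg_right h2 (by positivity : 0 ≤ ‖p b‖ + ‖q b‖)
  linarith

section Density

variable {G : Type u} [GroupoidStr G] (f : G → ℂ)

/-- The squared `ℓ²` norm of the restriction of `f` to a range fibre. -/
noncomputable def sqNorm (x : units (G := G)) : ℝ := ∑ᶠ b : RFiber G x, ‖f b.1‖ ^ 2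

/-- The squared modulus of `f`, corrected to have sum one on every range fibre: missing mass
is put at the unit, excess mass is scaled away. -/
noncomputable def density (b : G) : ℝ :=
  (‖f b‖ ^ 2 + max (1 - sqNorm f (r b)) 0 * (units (G := G)).indicator 1 b) /
    max (sqNorm f (r b)) 1

theorem density_nonneg (b : G) : 0 ≤ density f b := by
  have : 0 ≤ (units (G := G)).indicator (1 : G → ℝ) b :=
    Set.indicator_nonneg (fun _ _ => zero_le_one) _
  unfold density
  positivity

/-- The unit over `x`, as a point of the range fibre. -/
def unitPt (x : units (G := G)) : RFiber G x := ⟨x, r_unit x⟩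

open scoped Classical in
theorem indicator_units {x : units (G := G)} (b : RFiber G x) :
    (units (G := G)).indicator (1 : G → ℝ) b.1 = if b = unitPt x then 1 else 0 := by
  rw [Set.indicator_apply]
  refine if_congr ⟨fun h => Subtype.ext ?_, ?_⟩ rfl rfl
  · exact (congrArg Subtype.val (r_unit ⟨b.1, h⟩)).symm.trans (congrArg Subtype.val b.2)
  · rintro rfl
    exact x.2

theorem density_eq {x : units (G := G)} (b : RFiber G x) :
    density f b.1 = (‖f b.1‖ ^ 2 + max (1 - sqNorm f x) 0 * (units (G := G)).indicator 1 b.1) /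
      max (sqNorm f x) 1 := by
  rw [density, b.2]

theorem sum_indicator_units {x : units (G := G)} {S : Finset (RFiber G x)} (hS : unitPt x ∈ S) :
    ∑ b ∈ S, (units (G := G)).indicator (1 : G → ℝ) b.1 = 1 := by
  classical
  simp_rw [indicator_units]
  rw [Finset.sum_ite_eq', if_pos hS]

variable {f}

theorem sum_density {x : units (G := G)} {S : Finset (RFiber G x)} (hS : unitPt x ∈ S)
    (hf : ∑ b ∈ S, ‖f b.1‖ ^ 2 = sqNorm f x) : ∑ b ∈ S, density f b.1 = 1 := by
  simp_rw [density_eq]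
  rw [← Finset.sum_div, Finset.sum_add_distrib, ← Finset.mul_sum, sum_indicator_units hS, hf,
    mul_one, div_eq_one_iff_eq (by positivity)]
  rcases le_total (sqNorm f x) 1 with h | h
  · rw [max_eq_left (by linarith), max_eq_right h]; ring
  · rw [max_eq_right (by linarith), max_eq_left h]; ring

theorem sum_abs_density_sub_le {x : units (G := G)} {S : Finset (RFiber G x)} (hS : unitPt x ∈ S)
    (hf : ∑ b ∈ S, ‖f b.1‖ ^ 2 = sqNorm f x) :
    ∑ b ∈ S, |density f b.1 - ‖f b.1‖ ^ 2| ≤ |sqNorm f x - 1| := by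
  have h0 : 0 ≤ sqNorm f x := hf ▸ Finset.sum_nonneg fun _ _ => by positivity
  simp_rw [density_eq]
  rcases le_total (sqNorm f x) 1 with h | h
  · have : ∀ b ∈ S, |(‖f b.1‖ ^ 2 + max (1 - sqNorm f x) 0 * (units (G := G)).indicator 1 b.1) /
        max (sqNorm f x) 1 - ‖f b.1‖ ^ 2| =
        (1 - sqNorm f x) * (units (G := G)).indicator 1 b.1 := fun b _ => by
      rw [max_eq_left (by linarith), max_eq_right h, div_one, add_sub_cancel_left, abs_of_nonneg]
      exact mul_nonneg (by linarith) (Set.indicator_nonneg (fun _ _ => zero_le_one) _)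
    rw [Finset.sum_congr rfl this, ← Finset.mul_sum, sum_indicator_units hS, mul_one, abs_sub_comm]
    exact le_abs_self _
  · have : ∀ b ∈ S, |(‖f b.1‖ ^ 2 + max (1 - sqNorm f x) 0 * (units (G := G)).indicator 1 b.1) /
        max (sqNorm f x) 1 - ‖f b.1‖ ^ 2| = (1 - 1 / sqNorm f x) * ‖f b.1‖ ^ 2 := fun b _ => by
      rw [max_eq_right (by linarith), max_eq_left h, zero_mul, add_zero, abs_sub_comm,
        abs_of_nonneg]
      · ring
      · exact sub_nonneg.2 (div_le_self (by positivity) h)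
    rw [Finset.sum_congr rfl this, ← Finset.mul_sum, hf, sub_mul, one_div,
      inv_mul_cancel₀ (by linarith), one_mul]
    exact le_abs_self _

theorem eventually_sum_eq_sqNorm {x : units (G := G)}
    (hf : (Function.support fun b : RFiber G x => f b.1).Finite) :
    ∀ᶠ S : Finset (RFiber G x) in atTop, ∑ b ∈ S, ‖f b.1‖ ^ 2 = sqNorm f x := by
  filter_upwards [eventually_ge_atTop hf.toFinset] with S hS
  refine (finsum_eq_sum_of_support_subset _ fun b hb => hS ?_).symm
  simpa using hb

theorem density_eq_zero {x : units (G := G)} {b : RFiber G x} (h : f b.1 = 0)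
    (hb : b ≠ unitPt x) : density f b.1 = 0 := by
  classical
  rw [density_eq, h, indicator_units, if_neg hb]
  simp

end Density

section Amenable

variable {G : Type u} [TopologicalSpace G] [GroupoidStr G] [IsEtaleGroupoid G] {f : G → ℂ}

theorem continuous_sqNorm (hf : Continuous f) (hfc : HasCompactSupport f) :
    Continuous (sqNorm f) :=
  continuous_finsum_fiber isLocalHomeomorph_r continuous_id (K := tsupport f) hfc
    (F := fun _ b => ‖f b‖ ^ 2) ((hf.norm.pow 2).comp continuous_snd).continuousOn
    fun _ e _ he => by simp [image_eq_zero_of_notMem_tsupport he]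

theorem continuous_density (hf : Continuous f) (hfc : HasCompactSupport f) :
    Continuous (density f) := by
  have h1 := (continuous_sqNorm hf hfc).comp continuous_r
  have h2 : Continuous ((units (G := G)).indicator (1 : G → ℝ)) :=
    continuous_const.indicator fun a ha => by simp [isClopen_units.frontier_eq] at ha
  exact ((hf.norm.pow 2).add (((continuous_const.sub h1).max continuous_const).mul h2)).div
    (h1.max continuous_const) fun b => (lt_max_of_lt_right one_pos).ne'

variable [MeasurableSpace G] [BorelSpace G]

/-- The finite set of points of a range fibre which carries `density f`. -/
noncomputable def densitySupport (hfc : HasCompactSupport f) (x : units (G := G)) :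
    Finset (RFiber G x) :=
  open scoped Classical in insert (unitPt x) (finite_support_rFiber hfc x).toFinset

/-- The family of probability measures with density `density f`. -/
noncomputable def densityMeasure (hfc : HasCompactSupport f) (x : units (G := G)) :
    ProbabilityMeasure (RFiber G x) :=
  ofWeights (fun b => density f b.1) (densitySupport hfc x) (fun b => density_nonneg f b.1) <| by
    classical
    refine sum_density (Finset.mem_insert_self _ _) ?_
    refine (finsum_eq_sum_of_support_subset _ fun b hb => ?_).symm
    refine Finset.mem_coe.2 (Finset.mem_insert_of_mem ?_)
    simpa using hb

theorem densityMeasure_real_singleton (hfc : HasCompactSupport f) {x : units (G := G)}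
    (b : RFiber G x) : (densityMeasure hfc x : Measure (RFiber G x)).real {b} = density f b.1 := by
  classical
  refine ofWeights_real_singleton _ _ (fun b hb => ?_) b
  rw [densitySupport, Finset.mem_insert, not_or, Set.Finite.mem_toFinset,
    Function.notMem_support] at hb
  exact density_eq_zero hb.2 hb.1

theorem densityMeasure_compl (hfc : HasCompactSupport f) (x : units (G := G)) :
    (densityMeasure hfc x : Measure (RFiber G x)) (densitySupport hfc x : Set (RFiber G x))ᶜ = 0 :=
  ofWeights_compl _ _

theorem continuous_integral_densityMeasure (hf : Continuous f) (hfc : HasCompactSupport f)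
    {g : G → ℂ} (hg : Continuous g) (hgc : HasCompactSupport g) :
    Continuous fun x : units (G := G) =>
      ∫ a : RFiber G x, g a.1 ∂(densityMeasure hfc x : Measure (RFiber G x)) := by
  have h : ∀ x : units (G := G),
      ∫ a : RFiber G x, g a.1 ∂(densityMeasure hfc x : Measure (RFiber G x)) =
        ∑ᶠ a : RFiber G x, (density f a.1 : ℂ) * g a.1 := fun x => by
    have hfin := finite_support_rFiber hgc x
    rw [integral_eq_sum_of_support_subset _ (S := hfin.toFinset) (fun b hb => by simpa using hb),
      finsum_eq_sum_of_support_subset (s := hfin.toFinset) _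
        fun b hb => by simpa using right_ne_zero_of_mul hb]
    refine Finset.sum_congr rfl fun b _ => ?_
    rw [densityMeasure_real_singleton, Complex.real_smul]
  simp_rw [h]
  exact continuous_finsum_fiber isLocalHomeomorph_r continuous_id (K := tsupport g) hgc
    (F := fun _ b => (density f b : ℂ) * g b)
    (((Complex.continuous_ofReal.comp (continuous_density hf hfc)).mul hg).comp
      continuous_snd).continuousOn
    fun _ e _ he => by simp [image_eq_zero_of_notMem_tsupport he]

/-- The measures of density `density f` are nearly invariant by the arrows `k` at which the
coefficient of `f` is close to `1`. -/
theorem normDiff_densityMeasure_le (hfc : HasCompactSupport f) {k : G} {t : ℝ} (ht : 0 < t)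
    (ht1 : t ≤ 1) (hr : |sqNorm f (r k) - 1| ≤ 2 * t ^ 2) (hs : |sqNorm f (s k) - 1| ≤ 2 * t ^ 2)
    (hk : ∀ᶠ S : Finset (RFiber G (r k)) in atTop,
      ‖∑ b ∈ S, f b.1 * conj (f (ldiv k b.1)) - 1‖ ≤ 2 * t ^ 2) :
    normDiff (translate k (densityMeasure hfc (s k))) (densityMeasure hfc (r k)) ≤ 14 * t := by
  classical
  set e := ldivEquiv k (rfl : r k = r k) (rfl : s k = s k) with he
  have h1 := eventually_sum_eq_sqNorm (f := f) (finite_support_rFiber hfc (r k))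
  obtain ⟨S₂, hS₂⟩ := (eventually_sum_eq_sqNorm (f := f) (finite_support_rFiber hfc (s k)))
    |>.exists_forall_of_atTop
  -- a finite set of arrows which is large enough for all the sums involved
  obtain ⟨S, h1, hk, hge⟩ := (h1.and (hk.and (eventually_ge_atTop
    (densitySupport hfc (r k) ∪ (S₂ ∪ densitySupport hfc (s k)).map e.symm.toEmbedding)))).exists
  have hSr : densitySupport hfc (r k) ⊆ S := Finset.union_subset_left hge
  have hmap : S₂ ∪ densitySupport hfc (s k) ⊆ S.map e.toEmbedding := fun b hb => by
    refine Finset.mem_map.2 ⟨e.symm b, Finset.union_subset_right hge ?_, e.apply_symm_apply b⟩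
    exact Finset.mem_map.2 ⟨b, hb, rfl⟩
  have hsum : ∀ F : RFiber G (s k) → ℝ, ∑ b ∈ S.map e.toEmbedding, F b = ∑ b ∈ S, F (e b) :=
    fun F => Finset.sum_map _ _ _
  have h2 : ∑ b ∈ S.map e.toEmbedding, ‖f b.1‖ ^ 2 = sqNorm f (s k) :=
    hS₂ _ (Finset.union_subset_left hmap)
  have hd1 := sum_abs_density_sub_le (hSr (Finset.mem_insert_self _ _)) h1
  have hd2 := sum_abs_density_sub_le
    (Finset.union_subset_right hmap (Finset.mem_insert_self _ _)) h2
  rw [hsum] at h2 hd2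
  have hn : normDiff (translate k (densityMeasure hfc (s k))) (densityMeasure hfc (r k)) ≤
      ∑ b ∈ S, |density f (e b).1 - density f b.1| := by
    refine (normDiff_le_sum_abs_sub _ _ S ?_ ?_).trans_eq ?_
    · rw [translate, ProbabilityMeasure.toMeasure_map,
        Measure.map_apply (continuous_leftTranslation k).measurable S.measurableSet.compl]
      refine measure_mono_null (Set.subset_compl_comm.1 fun b hbS hb => hb ?_)
        (densityMeasure_compl hfc (s k))
      obtain ⟨c, hc, rfl⟩ := Finset.mem_map.1 (Finset.union_subset_right hmap hbS)
      rw [leftTranslation_eq]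
      simpa [he] using hc
    · exact measure_mono_null (Set.compl_subset_compl.2 (Finset.coe_subset.2 hSr))
        (densityMeasure_compl hfc (r k))
    · refine Finset.sum_congr rfl fun b _ => ?_
      rw [translate_real_singleton, densityMeasure_real_singleton, densityMeasure_real_singleton]
  have hmid := sum_abs_sq_sub_sq_le S (fun b => f b.1) (fun b => f (e b).1) ht
  rw [h1, h2] at hmid
  have hre : 1 - 2 * t ^ 2 ≤ (∑ b ∈ S, f b.1 * conj (f (e b).1)).re := by
    have h3 := (Complex.abs_re_le_norm _).trans hk
    rw [Complex.sub_re, Complex.one_re] at h3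
    have h4 := (abs_le.1 h3).1
    change _ ≤ (∑ b ∈ S, f b.1 * conj (f (ldiv k b.1))).re
    linarith
  have htri : ∑ b ∈ S, |density f (e b).1 - density f b.1| ≤
      ∑ b ∈ S, |density f (e b).1 - ‖f (e b).1‖ ^ 2| + ∑ b ∈ S, |‖f b.1‖ ^ 2 - ‖f (e b).1‖ ^ 2|
        + ∑ b ∈ S, |density f b.1 - ‖f b.1‖ ^ 2| := by
    rw [← Finset.sum_add_distrib, ← Finset.sum_add_distrib]
    refine Finset.sum_le_sum fun b _ => ?_
    rw [abs_sub_comm (‖f b.1‖ ^ 2), abs_sub_comm (density f b.1) (‖f b.1‖ ^ 2)]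
    refine le_trans (le_of_eq ?_) (abs_add_three _ _ _)
    congr 1; ring
  have ht2 : t ^ 2 ≤ t := by nlinarith
  have hmid2 : (sqNorm f (r k) + sqNorm f (s k) - 2 * (∑ b ∈ S, f b.1 * conj (f (e b).1)).re) /
      (2 * t) ≤ 4 * t := by
    rw [div_le_iff₀ (by positivity)]
    nlinarith [(abs_le.1 hr).2, (abs_le.1 hs).2]
  have hmid3 : t * (sqNorm f (r k) + sqNorm f (s k)) ≤ t * 6 :=
    mul_le_mul_of_nonneg_left (by nlinarith [(abs_le.1 hr).2, (abs_le.1 hs).2]) ht.le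
  nlinarith

/-- An étale groupoid with compactly supported functions of positive type which approximate `1`
uniformly on compact sets is amenable. -/
theorem isAmenable_of_exists_positive_type
    (hG : ∀ K : Set G, IsCompact K → ∀ ε : ℝ, 0 < ε → ∃ h : G → ℂ, Continuous h ∧
      HasCompactSupport h ∧ IsPositiveDefiniteKernel (fun q : RangePairs G => h (invMul q)) ∧
      ∀ a ∈ K, ‖h a - 1‖ ≤ ε) : IsAmenable G := by
  have key : ∀ i : Compacts G × ℕ, ∃ f : G → ℂ, ∃ hfc : HasCompactSupport f, Continuous f ∧
      ∀ k ∈ i.1, normDiff (translate k (densityMeasure hfc (s k))) (densityMeasure hfc (r k)) ≤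
        1 / ((i.2 : ℝ) + 1) := by
    rintro ⟨K, n⟩
    -- then the bound `14 t` of `normDiff_densityMeasure_le` is `1 / (n + 1)`
    set t : ℝ := 1 / (14 * ((n : ℝ) + 1)) with ht
    have ht0 : 0 < t := by positivity
    have ht1 : t ≤ 1 := by
      rw [ht, div_le_one (by positivity)]
      have : (0 : ℝ) ≤ n := n.cast_nonneg
      linarith
    have hval : Continuous (Subtype.val : units (G := G) → G) := continuous_subtype_val
    -- the sums of `|f|²` over the fibres are controlled by `h` at units, so the ranges and the
    -- sources of the arrows of `K` are added to `K`
    obtain ⟨h, hh, hc, hp, hK⟩ := hG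
      (K ∪ ((Subtype.val ∘ r) '' (K : Set G) ∪ (Subtype.val ∘ s) '' (K : Set G)))
      (K.isCompact.union ((K.isCompact.image (hval.comp continuous_r)).union
        (K.isCompact.image (hval.comp continuous_s)))) (t ^ 2) (by positivity)
    obtain ⟨f, hf, hfc, hfh⟩ := exists_approx_sqrt hh hc hp (ε := t ^ 2) (by positivity)
    refine ⟨f, hfc, hf, fun k hk => ?_⟩
    have hunit : ∀ x : units (G := G), ‖h x - 1‖ ≤ t ^ 2 → |sqNorm f x - 1| ≤ 2 * t ^ 2 := by
      intro x hx
      obtain ⟨S, h1, h2⟩ := ((hfh x (unitPt x) (unitPt x)).and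
        (eventually_sum_eq_sqNorm (finite_support_rFiber hfc x))).exists
      have h3 : ∑ b ∈ S, f (ldiv (unitPt x).1 b.1) * conj (f (ldiv (unitPt x).1 b.1)) =
          ((sqNorm f x : ℝ) : ℂ) := by
        rw [← h2, Complex.ofReal_sum]
        refine Finset.sum_congr rfl fun b _ => ?_
        rw [unitPt, ldiv_unit_left b.2, Complex.mul_conj']
        push_cast; rfl
      rw [h3, show ldiv (unitPt x).1 (unitPt x).1 = x from ldiv_unit_left (r_unit x)] at h1
      have h4 : ‖((sqNorm f x : ℝ) : ℂ) - 1‖ ≤ 2 * t ^ 2 := by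
        calc _ = ‖(((sqNorm f x : ℝ) : ℂ) - h x) + (h x - 1)‖ := by ring_nf
          _ ≤ _ := (norm_add_le _ _).trans (by linarith)
      rwa [← Complex.ofReal_one, ← Complex.ofReal_sub, Complex.norm_real, Real.norm_eq_abs] at h4
    have := normDiff_densityMeasure_le hfc ht0 ht1
      (hunit (r k) (hK _ (Or.inr (Or.inl ⟨k, hk, rfl⟩))))
      (hunit (s k) (hK _ (Or.inr (Or.inr ⟨k, hk, rfl⟩)))) (by
        filter_upwards [hfh (r k) (unitPt (r k)) ⟨k, rfl⟩] with S hS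
        have h3 : ∑ b ∈ S, f (ldiv (unitPt (r k)).1 b.1) * conj (f (ldiv k b.1)) =
            ∑ b ∈ S, f b.1 * conj (f (ldiv k b.1)) :=
          Finset.sum_congr rfl fun b _ => by rw [unitPt, ldiv_unit_left b.2]
        rw [h3, show ldiv (unitPt (r k)).1 k = k from ldiv_unit_left rfl] at hS
        calc _ = ‖(∑ b ∈ S, f b.1 * conj (f (ldiv k b.1)) - h k) + (h k - 1)‖ := by ring_nf
          _ ≤ _ := (norm_add_le _ _).trans (by linarith [hK k (Or.inl hk)]))
    refine this.trans_eq ?_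
    rw [ht]
    field_simp
  choose f hfc hf hinv using key
  refine ⟨Compacts G × ℕ, inferInstance, inferInstance, inferInstance,
    fun i => densityMeasure (hfc i), fun i x => ofWeights_regular _ _,
    fun i g hg hgc => continuous_integral_densityMeasure (hf i) (hfc i) hg hgc, fun K hK => ?_⟩
  refine tendstoUniformlyOn_of_compacts (φ := id) (fun i a ha => ?_) hK fun a ha => ha
  rw [Real.dist_eq, zero_sub, abs_neg, abs_of_nonneg (normDiff_nonneg _ _)]
  exact hinv i a ha

end Amenable

end TopGpd

/-! ### Kernels from an amenable action -/

namespace TopGpd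

open GroupoidStr TopologicalSpace

theorem isLocalHomeomorph_of_isOpenMap {E X : Type*} [TopologicalSpace E] [TopologicalSpace X]
    {f : E → X} (hc : Continuous f) (ho : IsOpenMap f) (hi : ∀ e, ∃ U ∈ 𝓝 e, Set.InjOn f U) :
    IsLocalHomeomorph f := by
  rw [isLocalHomeomorph_iff_isOpenEmbedding_restrict]
  intro e
  obtain ⟨U, hU, hinj⟩ := hi e
  obtain ⟨V, hVU, hV, heV⟩ := mem_nhds_iff.1 hU
  exact ⟨V, hV.mem_nhds heV, .of_continuous_injective_isOpenMap (hc.comp continuous_subtype_val)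
    (hinj.mono hVU).injective (ho.comp hV.isOpenMap_subtype_val)⟩

namespace SemidirectProduct

variable {G : Type u} [TopologicalSpace G] [GroupoidStr G] {Y : Type v} [TopologicalSpace Y]
  {A : GSpace G Y}

/-- The semi-direct product by an étale groupoid is étale. -/
instance [IsEtaleGroupoid G] : IsEtaleGroupoid (SemidirectProduct A) where
  isLocalHomeomorph_r := by
    refine isLocalHomeomorph_of_isOpenMap continuous_r IsLocallyCompactGroupoid.isOpenMap_r
      fun q => ?_
    refine ⟨_, SemidirectProduct.continuous_snd.continuousAt.eventually
      (eventually_localSection_apply (isLocalHomeomorph_r (G := G)) q.1.2), fun q₁ h₁ q₂ h₂ h => ?_⟩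
    have h1 : q₁.1.1 = q₂.1.1 := unit_injective A (congrArg Subtype.val h)
    have h2 : r q₁.1.2 = r q₂.1.2 := q₁.2.symm.trans ((congrArg A.p h1).trans q₂.2)
    refine ext_iff' h1 ?_
    rw [← h₁, ← h₂, h2]

/-- Over a compact set of arrows the semi-direct product is compact, as `p` is proper. -/
theorem isCompact_setOf_snd_mem [IsLocallyCompactGroupoid G] (hA : IsProperMap A.p) {K : Set G}
    (hK : IsCompact K) : IsCompact {q : SemidirectProduct A | q.1.2 ∈ K} := by
  have := A.t2Space
  have hcl : IsClosed {q : Y × G | A.p q.1 = r q.2} :=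
    isClosed_eq (A.continuous_p.comp _root_.continuous_fst)
      (TopGpd.continuous_r.comp _root_.continuous_snd)
  have h1 : IsCompact {q : SemidirectProduct A | q.1 ∈ (A.p ⁻¹' (r '' K)) ×ˢ K} :=
    hcl.isClosedEmbedding_subtypeVal.isCompact_preimage
      ((hA.isCompact_preimage (hK.image TopGpd.continuous_r)).prod hK)
  refine h1.of_isClosed_subset (hK.isClosed.preimage continuous_snd) fun q hq => ?_
  exact ⟨⟨_, hq, q.2.symm⟩, hq⟩

end SemidirectProduct

section Pullback

variable {G : Type u} [TopologicalSpace G] [GroupoidStr G] {Y : Type v} [TopologicalSpace Y]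
  {A : GSpace G Y} {σ : units (G := G) → Y} (hσ : ∀ x, A.p (σ x) = x)

/-- The map `a ↦ (σ (r a), a)` from `G` to `Y ⋊ G` given by a section `σ` of `Y`. -/
def sectionLift (a : G) : SemidirectProduct A := ⟨(σ (r a), a), hσ (r a)⟩

theorem r_sectionLift (a : G) :
    r (sectionLift hσ a) = ⟨SemidirectProduct.unit A (σ (r a)), _, rfl⟩ := rfl

/-- The map induced by a section on pairs of arrows with the same range. -/
def sectionLiftPair (q : RangePairs G) : RangePairs (SemidirectProduct A) :=
  ⟨(sectionLift hσ q.1.1, sectionLift hσ q.1.2), by rw [r_sectionLift, r_sectionLift, q.2]⟩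

theorem IsPositiveDefiniteKernel.comp_sectionLiftPair
    {k : RangePairs (SemidirectProduct A) → ℂ} (hk : IsPositiveDefiniteKernel k) :
    IsPositiveDefiniteKernel fun q => k (sectionLiftPair hσ q) := fun x n a c =>
  hk ⟨SemidirectProduct.unit A (σ x), _, rfl⟩ n
    (fun i => ⟨sectionLift hσ (a i).1, by rw [r_sectionLift, (a i).2]⟩) c

variable [IsLocallyCompactGroupoid G]

theorem continuous_sectionLiftPair (hc : Continuous σ) : Continuous (sectionLiftPair hσ) := by
  have h : Continuous (sectionLift hσ) :=
    ((hc.comp continuous_r).prodMk continuous_id).subtype_mk _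
  exact ((h.comp continuous_subtype_val.fst).prodMk
    (h.comp continuous_subtype_val.snd)).subtype_mk _

end Pullback

theorem IsTube.exists_isCompact {G : Type u} [TopologicalSpace G] [GroupoidStr G]
    {T : Set (RangePairs G)} (hT : IsTube T) :
    ∃ K : Set G, IsCompact K ∧ ∀ q ∈ T, invMul q ∈ K :=
  ⟨_, hT, fun q hq => subset_closure ⟨q, hq, rfl⟩⟩

theorem isTube_preimage {G : Type u} [TopologicalSpace G] [GroupoidStr G]
    [IsLocallyCompactGroupoid G] {K : Set G} (hK : IsCompact K) : IsTube (invMul ⁻¹' K) :=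
  hK.of_isClosed_subset isClosed_closure
    (closure_minimal (Set.image_preimage_subset _ _) hK.isClosed)

/-- If there are tube-supported kernels which are arbitrarily close to `1` on each tube, they can be
arranged in a net, indexed by the pairs of a compact set and a natural number. -/
theorem exists_net_of_forall_compact {G : Type u} [TopologicalSpace G] [GroupoidStr G]
    (h : ∀ K : Set G, IsCompact K → ∀ ε : ℝ, 0 < ε → ∃ k : RangePairs G → ℂ,
      (Continuous k ∧ (∃ C : ℝ, ∀ q, ‖k q‖ ≤ C) ∧ IsPositiveDefiniteKernel k ∧
        ∃ T : Set (RangePairs G), IsTube T ∧ tsupport k ⊆ T) ∧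
      ∀ q, invMul q ∈ K → ‖k q - 1‖ ≤ ε) :
    ∃ (I : Type u) (_ : Preorder I) (_ : IsDirectedOrder I) (_ : Nonempty I)
      (k : I → RangePairs G → ℂ),
      (∀ i, Continuous (k i) ∧ (∃ C : ℝ, ∀ q, ‖k i q‖ ≤ C) ∧ IsPositiveDefiniteKernel (k i) ∧
        ∃ T : Set (RangePairs G), IsTube T ∧ tsupport (k i) ⊆ T) ∧
      ∀ T : Set (RangePairs G), IsTube T → TendstoUniformlyOn k (fun _ => 1) atTop T := by
  choose k hk hk1 using fun i : Compacts G × ℕ =>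
    h i.1 i.1.isCompact (1 / ((i.2 : ℝ) + 1)) (by positivity)
  refine ⟨Compacts G × ℕ, inferInstance, inferInstance, inferInstance, k, hk, fun T hT => ?_⟩
  obtain ⟨K, hK, hTK⟩ := hT.exists_isCompact
  refine tendstoUniformlyOn_of_compacts (φ := invMul) (fun i q hq => ?_) hK hTK
  rw [dist_comm, dist_eq_norm]
  exact hk1 i q hq

/-- The functions of positive type on `Y ⋊ G` are pulled back to `G *ᵣ G` by the section. -/
theorem IsStronglyAmenableAtInfinity.exists_net {G : Type u} [TopologicalSpace G] [GroupoidStr G]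
    [IsEtaleGroupoid G] (hG : IsStronglyAmenableAtInfinity G) :
    ∃ (I : Type u) (_ : Preorder I) (_ : IsDirectedOrder I) (_ : Nonempty I)
      (k : I → RangePairs G → ℂ),
      (∀ i, Continuous (k i) ∧ (∃ C : ℝ, ∀ q, ‖k i q‖ ≤ C) ∧ IsPositiveDefiniteKernel (k i) ∧
        ∃ T : Set (RangePairs G), IsTube T ∧ tsupport (k i) ⊆ T) ∧
      ∀ T : Set (RangePairs G), IsTube T → TendstoUniformlyOn k (fun _ => 1) atTop T := by
  obtain ⟨Y, _, A, hA, hp, σ, hc, hσ⟩ := hG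
  refine exists_net_of_forall_compact fun K hK ε hε => ?_
  obtain ⟨h, hh, hhc, hpos, h1⟩ := IsAmenable.exists_positive_type hA
    (SemidirectProduct.isCompact_setOf_snd_mem hp hK) hε
  have hj := continuous_invMul.comp (continuous_sectionLiftPair hσ hc)
  refine ⟨fun q => h (invMul (sectionLiftPair hσ q)), ⟨hh.comp hj, ?_,
    hpos.comp_sectionLiftPair hσ, ?_⟩, fun q hq => h1 _ hq⟩
  -- the second component of `invMul (sectionLiftPair hσ q)` is `invMul q`, by definition
  · obtain ⟨C, hC⟩ := hh.bounded_above_of_compact_support hhc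
    exact ⟨C, fun q => hC _⟩
  · refine ⟨_, isTube_preimage (hhc.isCompact.image SemidirectProduct.continuous_snd), ?_⟩
    have hsub : tsupport (fun q => h (invMul (sectionLiftPair hσ q))) ⊆
        (invMul ∘ sectionLiftPair hσ) ⁻¹' tsupport h :=
      closure_minimal (fun q hq => subset_tsupport h hq) ((isClosed_tsupport h).preimage hj)
    exact hsub.trans fun q hq => ⟨_, hq, rfl⟩

end TopGpd

/-! ### Spaces of functions on the fibres of a local homeomorphism -/

namespace TopGpd

/-- The points are a base point `x` of `X` and a family, indexed by `J`, of functions on the fibre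
of `q : E → X` over `x`; the functions are extended by zero to `E`. -/
def FiberMaps {E X : Type*} (q : E → X) (J : Type*) : Type _ :=
  {y : X × (J → E → ℂ) // ∀ j e, q e ≠ y.1 → y.2 j e = 0}

namespace FiberMaps

section Basic

variable {E X J : Type*} {q : E → X}

/-- The base point. -/
def base (y : FiberMaps q J) : X := y.1.1

/-- The functions. -/
def val (y : FiberMaps q J) (j : J) (e : E) : ℂ := y.1.2 j e

theorem val_eq_zero (y : FiberMaps q J) (j : J) {e : E} (h : q e ≠ base y) : val y j e = 0 :=
  y.2 j e h

theorem ext_of {y y' : FiberMaps q J} (h : base y = base y')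
    (h' : ∀ j e, q e = base y → val y j e = val y' j e) : y = y' := by
  refine Subtype.ext (Prod.ext h (funext fun j => funext fun e => ?_))
  by_cases he : q e = base y
  · exact h' j e he
  · exact (val_eq_zero y j he).trans (val_eq_zero y' j (h ▸ he)).symm

/-- The integral of `ψ` against the measure on the fibre of density `val y j`. -/
noncomputable def testSum (y : FiberMaps q J) (j : J) (ψ : E → ℂ) : ℂ :=
  ∑ᶠ e : {e // q e = base y}, ψ e.1 * val y j e.1

variable [TopologicalSpace E] [TopologicalSpace X]

/-- The base point together with all integrals of compactly supported continuous functions. -/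
noncomputable def testMap (y : FiberMaps q J) :
    X × (J → {ψ : E → ℂ // Continuous ψ ∧ HasCompactSupport ψ} → ℂ) :=
  (base y, fun j ψ => testSum y j ψ.1)

/-- The vague topology, the functions being regarded as densities on the fibres. -/
noncomputable instance : TopologicalSpace (FiberMaps q J) :=
  TopologicalSpace.induced testMap inferInstance

theorem isInducing_testMap : IsInducing (testMap : FiberMaps q J → _) := ⟨rfl⟩

theorem continuous_base : Continuous (base : FiberMaps q J → X) :=
  have h : Continuous fun y : FiberMaps q J => (testMap y).1 := isInducing_testMap.continuous.fst
  h

theorem continuous_testSum (j : J) {ψ : E → ℂ} (hψ : Continuous ψ) (hc : HasCompactSupport ψ) :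
    Continuous fun y : FiberMaps q J => testSum y j ψ :=
  (continuous_apply (⟨ψ, hψ, hc⟩ : {ψ : E → ℂ // Continuous ψ ∧ HasCompactSupport ψ})).comp
    ((continuous_apply j).comp (continuous_snd.comp isInducing_testMap.continuous))

theorem tendsto_nhds_iff {Z : Type*} {l : Filter Z} {f : Z → FiberMaps q J} {y : FiberMaps q J} :
    Tendsto f l (𝓝 y) ↔ Tendsto (fun z => base (f z)) l (𝓝 (base y)) ∧
      ∀ j, ∀ ψ : E → ℂ, Continuous ψ → HasCompactSupport ψ →
        Tendsto (fun z => testSum (f z) j ψ) l (𝓝 (testSum y j ψ)) := by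
  rw [isInducing_testMap.tendsto_nhds_iff, Prod.tendsto_iff, tendsto_pi_nhds]
  simp only [tendsto_pi_nhds]
  exact and_congr_right fun _ => forall_congr' fun j =>
    ⟨fun h ψ h1 h2 => h ⟨ψ, h1, h2⟩, fun h ψ => h ψ.1 ψ.2.1 ψ.2.2⟩

end Basic

section LocalHomeomorph

variable {E X J : Type*} {q : E → X} [TopologicalSpace E] [TopologicalSpace X]
  [T2Space E]

/-- The evaluation map is continuous: a bump function supported near `e₀` isolates the value at
points near `e₀`. -/
theorem continuousOn_eval [LocallyCompactSpace E] (hq : IsLocalHomeomorph q) (j : J) :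
    ContinuousOn (fun z : FiberMaps q J × E => val z.1 j z.2) {z | q z.2 = base z.1} := by
  rintro ⟨y₀, e₀⟩ h₀
  obtain ⟨ψ, hψ, hψc, hψ1, -, hψi⟩ := exists_bump hq e₀
  have hc := (continuous_testSum (q := q) j (ψ := fun e => (ψ e : ℂ))
    (Complex.continuous_ofReal.comp hψ)
    (hψc.comp_left (g := ((↑) : ℝ → ℂ)) Complex.ofReal_zero)).comp (continuous_fst (Y := E))
  have key : ∀ z : FiberMaps q J × E, q z.2 = base z.1 → ψ z.2 = 1 →
      testSum z.1 j (fun e => (ψ e : ℂ)) = val z.1 j z.2 := by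
    rintro ⟨y, e⟩ h h1
    have he : (ψ e : ℂ) ≠ 0 := by rw [h1]; simp
    have := finsum_fiber_mul_eq (q := q) (ψ := fun e => (ψ e : ℂ)) (g := val y j) he
      fun e₁ e₂ g1 g2 => hψi e₁ e₂ (by exact_mod_cast g1) (by exact_mod_cast g2)
    rw [testSum, ← h, this, h1, Complex.ofReal_one, one_mul]
  refine hc.continuousAt.continuousWithinAt.congr_of_eventuallyEq ?_
    (key (y₀, e₀) h₀ hψ1.self_of_nhds).symm
  have hev : ∀ᶠ z : FiberMaps q J × E in 𝓝 (y₀, e₀), ψ z.2 = 1 :=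
    (continuous_snd.tendsto (y₀, e₀)).eventually hψ1
  filter_upwards [self_mem_nhdsWithin, mem_nhdsWithin_of_mem_nhds hev] with z hz h1
  exact (key z hz h1).symm

/-- A map into `FiberMaps` is continuous as soon as base points and values depend continuously on
the parameter. -/
theorem continuous_of [T2Space X] (hq : IsLocalHomeomorph q) {Z : Type*} [TopologicalSpace Z]
    {f : Z → FiberMaps q J} (hb : Continuous fun z => base (f z))
    (hv : ∀ j, ContinuousOn (fun z : Z × E => val (f z.1) j z.2) {z | q z.2 = base (f z.1)}) :
    Continuous f := by
  rw [isInducing_testMap.continuous_iff]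
  refine hb.prodMk (continuous_pi fun j => continuous_pi fun ψ => ?_)
  exact continuous_finsum_fiber hq hb (K := tsupport ψ.1) ψ.2.2
    (F := fun z e => ψ.1 e * val (f z) j e)
    ((ψ.2.1.comp continuous_snd).continuousOn.mul (hv j))
    fun z e _ he => by simp [image_eq_zero_of_notMem_tsupport he]

theorem t2Space [T2Space X] [LocallyCompactSpace E] (hq : IsLocalHomeomorph q) :
    T2Space (FiberMaps q J) := by
  refine T2Space.of_injective_continuous (f := testMap) (fun y y' h => ?_)
    isInducing_testMap.continuous
  have hb : base y = base y' := (congrArg Prod.fst h : (testMap y).1 = (testMap y').1)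
  refine ext_of hb fun j e he => ?_
  obtain ⟨ψ, hψ, hψc, hψ1, -, hψi⟩ := exists_bump hq e
  have h1 : testSum y j (fun e => (ψ e : ℂ)) = testSum y' j (fun e => (ψ e : ℂ)) :=
    congrFun (congrFun (congrArg Prod.snd h) j) ⟨_, Complex.continuous_ofReal.comp hψ,
      hψc.comp_left (g := ((↑) : ℝ → ℂ)) Complex.ofReal_zero⟩
  have hone := hψ1.self_of_nhds
  have hne : (ψ e : ℂ) ≠ 0 := by rw [hone]; simp
  have key := fun g : E → ℂ => finsum_fiber_mul_eq (q := q) (ψ := fun e => (ψ e : ℂ)) (g := g) hne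
      fun e₁ e₂ g1 g2 => hψi e₁ e₂ (by exact_mod_cast g1) (by exact_mod_cast g2)
  rw [testSum, testSum, ← hb, ← he, key, key, hone] at h1
  simpa using h1

/-- Values along a section converge to the value at the limit point. -/
theorem tendsto_val_section [LocallyCompactSpace E] (hq : IsLocalHomeomorph q)
    (y : FiberMaps q J) (j : J) {e : E} (he : q e = base y) :
    Tendsto (fun y' => val y' j (localSection hq e (base y'))) (𝓝 y) (𝓝 (val y j e)) := by
  have h1 := tendsto_localSection hq e
  have h2 := eventually_apply_localSection hq e
  rw [he] at h1 h2
  have hb := (continuous_base (q := q) (J := J)).continuousAt (x := y)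
  exact ((continuousOn_eval hq j) (y, e) he).tendsto.comp (tendsto_nhdsWithin_iff.2
    ⟨tendsto_id.prodMk_nhds (h1.comp hb), hb.eventually h2⟩)

/-- Bounded families of functions are compact over compact sets of base points: this is
Tychonoff's theorem, the coordinates being transported by local sections. -/
theorem exists_ultrafilter_le_nhds [T2Space X] (hq : IsLocalHomeomorph q) {C : J → ℝ}
    {𝒰 : Ultrafilter (FiberMaps q J)} (h𝒰 : ∀ᶠ y in (𝒰 : Filter (FiberMaps q J)),
      ∀ j e, ‖val y j e‖ ≤ C j) {x : X} (hx : Tendsto base (𝒰 : Filter (FiberMaps q J)) (𝓝 x)) :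
    ∃ y : FiberMaps q J, base y = x ∧ (𝒰 : Filter (FiberMaps q J)) ≤ 𝓝 y := by
  classical
  -- the coordinate at `e` converges along the ultrafilter, once transported to nearby fibres
  have hlim : ∀ j e, ∃ l : ℂ, Tendsto (fun y => val y j (localSection hq e (base y)))
      (𝒰 : Filter (FiberMaps q J)) (𝓝 l) := by
    intro j e
    obtain ⟨l, -, hl⟩ := (isCompact_closedBall (0 : ℂ) (C j)).ultrafilter_le_nhds
      (𝒰.map fun y => val y j (localSection hq e (base y))) (by
        rw [Ultrafilter.coe_map, le_principal_iff, mem_map]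
        filter_upwards [h𝒰] with y hy
        simpa using hy j _)
    exact ⟨l, hl⟩
  choose L hL using hlim
  refine ⟨⟨(x, fun j e => if q e = x then L j e else 0), fun j e h => if_neg h⟩, rfl, ?_⟩
  refine tendsto_id'.1 (tendsto_nhds_iff.2 ⟨hx, fun j ψ hψ hψc => ?_⟩)
  have hev := eventually_finsum_fiber_eq (M := ℂ) hq (K := tsupport ψ) hψc x
  set T := (finite_inter_fiber hq (K := tsupport ψ) hψc x).toFinset with hT
  have hTx : ∀ e ∈ T, q e = x := fun e he => by
    have : e ∈ tsupport ψ ∩ q ⁻¹' {x} := by simpa [hT] using he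
    exact this.2
  have hzero : ∀ (g : E → ℂ) e, e ∉ tsupport ψ → ψ e * g e = 0 := fun g e he => by
    rw [image_eq_zero_of_notMem_tsupport he, zero_mul]
  -- the integrals are finite sums of values along the local sections, near `x` and at `x`
  have h1 : testSum (⟨(x, fun j e => if q e = x then L j e else 0), fun j e h => if_neg h⟩ :
      FiberMaps q J) j ψ = ∑ e ∈ T, ψ e * L j e := by
    have := hev.self_of_nhds (fun e => ψ e * if q e = x then L j e else 0)
      fun e _ he => hzero (fun e => if q e = x then L j e else 0) e he
    refine this.trans (Finset.sum_congr rfl fun e he => ?_)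
    have hs : localSection hq e x = e := by
      rw [← hTx e he, localSection_apply]
    rw [hs, if_pos (hTx e he)]
  have h2 : Tendsto (fun y : FiberMaps q J => ∑ e ∈ T, ψ (localSection hq e (base y)) *
      val y j (localSection hq e (base y))) (𝒰 : Filter (FiberMaps q J))
      (𝓝 (∑ e ∈ T, ψ e * L j e)) := by
    refine tendsto_finsetSum _ fun e he => Tendsto.mul ?_ (hL j e)
    have := tendsto_localSection hq e
    rw [hTx e he] at this
    exact (hψ.tendsto e).comp (this.comp hx)
  rw [h1]
  refine h2.congr' ?_
  filter_upwards [hx.eventually hev] with y hy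
  exact (hy (fun e => ψ e * val y j e) fun e _ he => hzero _ e he).symm

end LocalHomeomorph

end FiberMaps

end TopGpd

/-! ### The space of kernels and its action -/

namespace TopGpd

open GroupoidStr TopologicalSpace

section RangePairs

variable {G : Type u} [GroupoidStr G]

/-- The common range of a pair of arrows. -/
def pairRange (e : RangePairs G) : units (G := G) := r e.1.1

/-- The pair `(a⁻¹ b, a⁻¹ c)`. -/
def translatePair (a : G) (e : RangePairs G) (h : r a = pairRange e) : RangePairs G :=
  ⟨(invMul ⟨(a, e.1.1), h⟩, invMul ⟨(a, e.1.2), h.trans e.2⟩), by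
    have h₁ : r a = r e.1.1 := h
    have h₂ : r a = r e.1.2 := h.trans e.2
    have key : r (invMul ⟨(a, e.1.1), h₁⟩) = r (invMul ⟨(a, e.1.2), h₂⟩) := by
      rw [← ldiv_eq h₁, ← ldiv_eq h₂, r_ldiv h₁, r_ldiv h₂]
    exact key⟩

theorem translatePair_val (a : G) (e : RangePairs G) (h : r a = pairRange e) :
    (translatePair a e h).1 = (ldiv a e.1.1, ldiv a e.1.2) := by
  rw [ldiv_eq h, ldiv_eq (h.trans e.2)]; rfl

theorem pairRange_translatePair (a : G) (e : RangePairs G) (h : r a = pairRange e) :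
    pairRange (translatePair a e h) = s a := by
  rw [pairRange, translatePair_val]; exact r_ldiv h

theorem invMul_translatePair (a : G) (e : RangePairs G) (h : r a = pairRange e) :
    invMul (translatePair a e h) = invMul e := by
  rw [invMul_eq, invMul_eq, translatePair_val]
  exact ldiv_ldiv h (h.trans e.2)

theorem ldiv_mul {a b c : G} (hab : s a = r b) (hc : r a = r c) :
    ldiv (mul a b hab) c = ldiv b (ldiv a c) := by
  have h1 : r (mul a b hab) = r a := r_mul _ _ _
  conv_rhs => rw [← inv_mul_cancel_left' a b hab]
  rw [ldiv_ldiv h1.symm hc]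

theorem ldiv_inv_ldiv {a b : G} (h : r a = r b) : ldiv (inv a) (ldiv a b) = b := by
  rw [← ldiv_unit_right (x := r a) rfl, ldiv_ldiv (r_unit _).symm h, ldiv_unit_left h.symm]

theorem invMul_unit_left (a : G) : invMul (⟨(r a, a), r_unit _⟩ : RangePairs G) = a :=
  (invMul_eq _).trans (ldiv_unit_left rfl)

end RangePairs

section Etale

variable {G : Type u} [TopologicalSpace G] [GroupoidStr G] [IsEtaleGroupoid G]

/-- The space of pairs of arrows with the same range is a fibre product of local homeomorphisms. -/
theorem isLocalHomeomorph_pairRange :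
    IsLocalHomeomorph (pairRange : RangePairs G → units (G := G)) := by
  have hr := isLocalHomeomorph_r (G := G)
  have hc : Continuous (pairRange : RangePairs G → units (G := G)) :=
    continuous_r.comp continuous_subtype_val.fst
  refine isLocalHomeomorph_of_isOpenMap hc (fun W hW => ?_) fun e => ?_
  · rw [isOpen_iff_mem_nhds]
    rintro _ ⟨⟨⟨a, b⟩, hab⟩, hmem, rfl⟩
    have hab : r a = r b := hab
    obtain ⟨V, hV, rfl⟩ := isOpen_induced_iff.1 hW
    -- move along a pair of local sections through `a` and `b`
    have ta := tendsto_localSection hr a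
    have tb := tendsto_localSection hr b
    have ea := eventually_apply_localSection hr a
    have eb := eventually_apply_localSection hr b
    rw [← hab] at tb eb
    filter_upwards [ea, eb, (ta.prodMk_nhds tb).eventually (hV.mem_nhds hmem)] with x h1 h2 h3
    exact ⟨⟨(localSection hr a x, localSection hr b x), h1.trans h2.symm⟩, h3, h1⟩
  · have c1 : Continuous fun e : RangePairs G => e.1.1 := continuous_subtype_val.fst
    have c2 : Continuous fun e : RangePairs G => e.1.2 := continuous_subtype_val.snd
    refine ⟨_, (c1.continuousAt.eventually (eventually_localSection_apply hr e.1.1)).and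
      (c2.continuousAt.eventually (eventually_localSection_apply hr e.1.2)),
      fun e₁ h₁ e₂ h₂ h => ?_⟩
    have h : r e₁.1.1 = r e₂.1.1 := h
    have h' : r e₁.1.2 = r e₂.1.2 := e₁.2.symm.trans (h.trans e₂.2)
    refine Subtype.ext (Prod.ext ?_ ?_)
    · rw [← h₁.1, ← h₂.1, h]
    · rw [← h₁.2, ← h₂.2, h']

instance instLocallyCompactSpaceRangePairs : LocallyCompactSpace (RangePairs G) :=
  isClosed_rangePairs.isClosedEmbedding_subtypeVal.locallyCompactSpace

end Etale

/-- A family of positive definite kernels `k j`, with bounds `C j`, supported where `a⁻¹ b` is in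
the compact set `D j`, and at distance at most `δ j` from `1` where `a⁻¹ b` is in the open set
`U j`. -/
structure KernelFamily (G : Type u) [TopologicalSpace G] [GroupoidStr G] (J : Type u) where
  /-- the kernels -/
  k : J → RangePairs G → ℂ
  /-- the bounds -/
  C : J → ℝ
  /-- the supports -/
  D : J → Set G
  /-- the sets of good approximation -/
  U : J → Set G
  /-- the errors -/
  δ : J → ℝ
  continuous_k : ∀ j, Continuous (k j)
  C_nonneg : ∀ j, 0 ≤ C j
  isCompact_D : ∀ j, IsCompact (D j)
  isOpen_U : ∀ j, IsOpen (U j)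
  norm_le : ∀ j e, ‖k j e‖ ≤ C j
  eq_zero : ∀ j e, invMul e ∉ D j → k j e = 0
  norm_sub_one_le : ∀ j e, invMul e ∈ U j → ‖k j e - 1‖ ≤ δ j
  posDef : ∀ j, IsPositiveDefiniteKernel (k j)

namespace KernelFamily

open FiberMaps

section Translate

variable {G : Type u} [GroupoidStr G] {J : Type*}

open scoped Classical in
/-- The translate of a family of kernels, `(a y)(b, c) = y(a⁻¹ b, a⁻¹ c)`. -/
noncomputable def translateMap (a : G) (y : FiberMaps (pairRange (G := G)) J) :
    FiberMaps (pairRange (G := G)) J :=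
  ⟨(r a, fun j e => if h : r a = pairRange e then val y j (translatePair a e h) else 0),
    fun _ _ h => dif_neg (Ne.symm h)⟩

theorem val_translateMap (a : G) (y : FiberMaps (pairRange (G := G)) J) (j : J) {e : RangePairs G}
    (h : r a = pairRange e) : val (translateMap a y) j e = val y j (translatePair a e h) :=
  dif_pos h

theorem val_translateMap_of_ne (a : G) (y : FiberMaps (pairRange (G := G)) J) (j : J)
    {e : RangePairs G} (h : r a ≠ pairRange e) : val (translateMap a y) j e = 0 :=
  dif_neg h

end Translate

variable {G : Type u} [TopologicalSpace G] [GroupoidStr G] {J : Type u} (κ : KernelFamily G J)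

/-- The families of kernels on a single range fibre `Gˣ` which obey the constraints of `κ`. -/
structure Admissible (y : FiberMaps (pairRange (G := G)) J) : Prop where
  norm_le : ∀ j e, ‖val y j e‖ ≤ κ.C j
  eq_zero : ∀ j e, invMul e ∉ κ.D j → val y j e = 0
  norm_sub_one_le : ∀ j e, pairRange e = base y → invMul e ∈ κ.U j → ‖val y j e - 1‖ ≤ κ.δ j
  posDef : ∀ j, IsPositiveDefiniteKernel (val y j)

/-- The space of all families of kernels on the range fibres which obey the constraints of `κ`. -/
def Space : Type u := {y : FiberMaps (pairRange (G := G)) J // κ.Admissible y}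

noncomputable instance : TopologicalSpace κ.Space := inferInstanceAs (TopologicalSpace
  {y : FiberMaps (pairRange (G := G)) J // κ.Admissible y})

variable {κ}

/-- The range fibre on which the kernels live. -/
def Space.p (y : κ.Space) : units (G := G) := base y.1

theorem Space.continuous_p : Continuous (Space.p : κ.Space → units (G := G)) :=
  continuous_base.comp continuous_subtype_val

theorem Admissible.translateMap {y : FiberMaps (pairRange (G := G)) J} (hy : κ.Admissible y)
    {a : G} (ha : s a = base y) : κ.Admissible (translateMap a y) where
  norm_le j e := by
    by_cases h : r a = pairRange e
    · rw [val_translateMap a y j h]; exact hy.norm_le j _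
    · rw [val_translateMap_of_ne a y j h, norm_zero]; exact κ.C_nonneg j
  eq_zero j e he := by
    by_cases h : r a = pairRange e
    · rw [val_translateMap a y j h]
      exact hy.eq_zero j _ (by rwa [invMul_translatePair])
    · rw [val_translateMap_of_ne a y j h]
  norm_sub_one_le j e he hU := by
    have h : r a = pairRange e := Eq.symm he
    rw [val_translateMap a y j h]
    exact hy.norm_sub_one_le j _ ((pairRange_translatePair a e h).trans ha)
      (by rwa [invMul_translatePair])
  posDef j x n b c := by
    by_cases h : r a = x
    · refine (hy.posDef j (s a) n (fun i => ldivEquiv a h rfl (b i)) c).trans_eq ?_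
      refine Finset.sum_congr rfl fun i _ => Finset.sum_congr rfl fun l _ => ?_
      rw [val_translateMap a y j (e := ⟨((b i).1, (b l).1), (b i).2.trans (b l).2.symm⟩)
        (h.trans (b i).2.symm)]
      congr 2
      exact Subtype.ext (translatePair_val a ⟨((b i).1, (b l).1), (b i).2.trans (b l).2.symm⟩
          (h.trans (b i).2.symm)).symm
    · refine (Finset.sum_nonneg fun i _ => Finset.sum_nonneg fun l _ => ?_)
      rw [val_translateMap_of_ne a y j (e := ⟨((b i).1, (b l).1), (b i).2.trans (b l).2.symm⟩)
        fun h' => h (h'.trans (b i).2), mul_zero]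

open scoped Classical in
/-- The restriction of the kernels of `κ` to the range fibre over `x`. -/
noncomputable def restrictMap (κ : KernelFamily G J) (x : units (G := G)) :
    FiberMaps (pairRange (G := G)) J :=
  ⟨(x, fun j e => if pairRange e = x then κ.k j e else 0), fun _ _ h => if_neg h⟩

theorem val_restrictMap {x : units (G := G)} (j : J) {e : RangePairs G} (h : pairRange e = x) :
    val (restrictMap κ x) j e = κ.k j e := if_pos h

theorem val_restrictMap_of_ne {x : units (G := G)} (j : J) {e : RangePairs G}
    (h : pairRange e ≠ x) : val (restrictMap κ x) j e = 0 := if_neg h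

theorem admissible_restrictMap (x : units (G := G)) : κ.Admissible (restrictMap κ x) where
  norm_le j e := by
    by_cases h : pairRange e = x
    · rw [val_restrictMap j h]; exact κ.norm_le j _
    · rw [val_restrictMap_of_ne j h, norm_zero]; exact κ.C_nonneg j
  eq_zero j e he := by
    by_cases h : pairRange e = x
    · rw [val_restrictMap j h]; exact κ.eq_zero j _ he
    · rw [val_restrictMap_of_ne j h]
  norm_sub_one_le j e he hU := by
    have he : pairRange e = x := he
    rw [val_restrictMap j he]
    exact κ.norm_sub_one_le j _ hU
  posDef j x' n b c := by
    by_cases h : x' = x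
    · refine (κ.posDef j x' n b c).trans_eq ?_
      refine Finset.sum_congr rfl fun i _ => Finset.sum_congr rfl fun l _ => ?_
      rw [val_restrictMap j (e := ⟨((b i).1, (b l).1), (b i).2.trans (b l).2.symm⟩)
        ((b i).2.trans h)]
    · refine (Finset.sum_nonneg fun i _ => Finset.sum_nonneg fun l _ => ?_)
      rw [val_restrictMap_of_ne j (e := ⟨((b i).1, (b l).1), (b i).2.trans (b l).2.symm⟩)
        fun h' => h ((b i).2.symm.trans h'), mul_zero]

section Topology

variable [IsEtaleGroupoid G]

/-- The constraints are closed conditions: they only involve finitely many values, which can be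
followed along local sections. -/
theorem Admissible.of_ultrafilter {𝒰 : Ultrafilter (FiberMaps (pairRange (G := G)) J)}
    (h𝒰 : ∀ᶠ y in (𝒰 : Filter (FiberMaps (pairRange (G := G)) J)), κ.Admissible y)
    {y : FiberMaps (pairRange (G := G)) J}
    (hy : (𝒰 : Filter (FiberMaps (pairRange (G := G)) J)) ≤ 𝓝 y) : κ.Admissible y := by
  set l := (𝒰 : Filter (FiberMaps (pairRange (G := G)) J))
  have hq := isLocalHomeomorph_pairRange (G := G)
  have hval : ∀ j {e}, pairRange e = base y →
      Tendsto (fun y' => val y' j (localSection hq e (base y'))) l (𝓝 (val y j e)) :=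
    fun j e he => (tendsto_val_section hq y j he).mono_left hy
  have hbase : Tendsto base l (𝓝 (base y)) := continuous_base.continuousAt.mono_left hy
  have hsec : ∀ {e}, pairRange e = base y →
      Tendsto (fun y' : FiberMaps (pairRange (G := G)) J => localSection hq e (base y')) l (𝓝 e) :=
    fun {e} he => by
      have := tendsto_localSection hq e
      rw [he] at this
      exact this.comp hbase
  have hpr : ∀ {e}, pairRange e = base y →
      ∀ᶠ y' in l, pairRange (localSection hq e (base y')) = base y' := fun {e} he => by
    have := eventually_apply_localSection hq e
    rw [he] at this
    exact hbase.eventually this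
  refine ⟨fun j e => ?_, fun j e he => ?_, fun j e he hU => ?_, fun j x n b c => ?_⟩
  · by_cases he : pairRange e = base y
    · refine le_of_tendsto (hval j he).norm ?_
      filter_upwards [h𝒰] with y' hy' using hy'.norm_le j _
    · rw [val_eq_zero y j he, norm_zero]; exact κ.C_nonneg j
  · by_cases hb : pairRange e = base y
    · refine tendsto_nhds_unique (hval j hb) (tendsto_const_nhds.congr' ?_)
      have := (continuous_invMul.continuousAt.tendsto.comp (hsec hb)).eventually
        ((κ.isCompact_D j).isClosed.isOpen_compl.mem_nhds he)
      filter_upwards [h𝒰, this] with y' hy' h' using (hy'.eq_zero j _ h').symm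
    · exact val_eq_zero y j hb
  · refine le_of_tendsto ((hval j he).sub_const 1).norm ?_
    have := (continuous_invMul.continuousAt.tendsto.comp (hsec he)).eventually
      ((κ.isOpen_U j).mem_nhds hU)
    filter_upwards [h𝒰, this, hpr he] with y' hy' h' h'' using hy'.norm_sub_one_le j _ h'' h'
  · by_cases hx : x = base y
    · subst hx
      have hr := isLocalHomeomorph_r (G := G)
      set e : Fin n → Fin n → RangePairs G := fun i m =>
        ⟨((b i).1, (b m).1), (b i).2.trans (b m).2.symm⟩ with he
      have heb : ∀ i m, pairRange (e i m) = base y := fun i m => (b i).2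
      have hlim : Tendsto (fun y' => ∑ i, ∑ m, conj (c i) * c m *
          val y' j (localSection hq (e i m) (base y'))) l
          (𝓝 (∑ i, ∑ m, conj (c i) * c m * val y j (e i m))) :=
        tendsto_finsetSum _ fun i _ => tendsto_finsetSum _ fun m _ =>
          (hval j (heb i m)).const_mul _
      refine ge_of_tendsto hlim ?_
      -- the local sections through the pairs are made of local sections through the arrows
      have h1 : ∀ᶠ y' in l, ∀ i m, (localSection hq (e i m) (base y')).1 =
          (localSection hr (b i).1 (base y'), localSection hr (b m).1 (base y')) := by
        refine eventually_all.2 fun i => eventually_all.2 fun m => ?_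
        have c1 := (continuous_subtype_val.fst.tendsto (e i m)).comp (hsec (heb i m))
        have c2 := (continuous_subtype_val.snd.tendsto (e i m)).comp (hsec (heb i m))
        filter_upwards [c1.eventually (eventually_localSection_apply hr (b i).1),
          c2.eventually (eventually_localSection_apply hr (b m).1), hpr (heb i m)] with y' h1 h2 h3
        have h4 : r (localSection hq (e i m) (base y')).1.2 = base y' :=
          (localSection hq (e i m) (base y')).2.symm.trans h3
        refine Prod.ext ?_ ?_
        · refine Eq.trans h1.symm ?_
          exact congrArg _ h3
        · refine Eq.trans h2.symm ?_
          exact congrArg _ h4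
      have h2 : ∀ᶠ y' in l, ∀ i, r (localSection hr (b i).1 (base y')) = base y' := by
        refine eventually_all.2 fun i => ?_
        have := eventually_apply_localSection hr (b i).1
        rw [(b i).2] at this
        exact hbase.eventually this
      filter_upwards [h𝒰, h1, h2] with y' hy' h1 h2
      refine (hy'.posDef j (base y') n (fun i => ⟨_, h2 i⟩) c).trans_eq ?_
      refine Finset.sum_congr rfl fun i _ => Finset.sum_congr rfl fun m _ => ?_
      congr 2
      exact Subtype.ext (h1 i m).symm
    · refine (Finset.sum_nonneg fun i _ => Finset.sum_nonneg fun m _ => ?_)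
      rw [val_eq_zero y j (e := ⟨((b i).1, (b m).1), (b i).2.trans (b m).2.symm⟩)
        fun h' => hx ((b i).2.symm.trans h'), mul_zero]

/-- Bounds make the space of kernels relatively compact over compact sets of units, and the
constraints make it closed. -/
theorem Space.isProperMap_p : IsProperMap (Space.p : κ.Space → units (G := G)) := by
  rw [isProperMap_iff_ultrafilter]
  refine ⟨Space.continuous_p, fun 𝒰 x hx => ?_⟩
  have had : ∀ᶠ y in (𝒰.map Subtype.val : Filter (FiberMaps (pairRange (G := G)) J)),
      κ.Admissible y := Eventually.of_forall (f := (𝒰 : Filter κ.Space)) fun y => y.2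
  obtain ⟨y, hyx, hy⟩ := exists_ultrafilter_le_nhds isLocalHomeomorph_pairRange
    (𝒰 := 𝒰.map Subtype.val) (C := κ.C) (had.mono fun y hy => hy.norm_le) (x := x) hx
  exact ⟨⟨y, Admissible.of_ultrafilter had hy⟩, hyx, tendsto_id'.1
    (IsInducing.subtypeVal.tendsto_nhds_iff.2 hy)⟩

theorem Space.t2Space : T2Space κ.Space :=
  have := FiberMaps.t2Space (J := J) (isLocalHomeomorph_pairRange (G := G))
  inferInstanceAs (T2Space {y : FiberMaps (pairRange (G := G)) J // κ.Admissible y})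

theorem locallyCompactSpace_units : LocallyCompactSpace (units (G := G)) :=
  isClopen_units.isClosed.isClosedEmbedding_subtypeVal.locallyCompactSpace

theorem Space.locallyCompactSpace : LocallyCompactSpace κ.Space := by
  have := Space.t2Space (κ := κ)
  have := locallyCompactSpace_units (G := G)
  have : WeaklyLocallyCompactSpace κ.Space := ⟨fun y => by
    obtain ⟨C, hC, hyC⟩ := exists_compact_mem_nhds (Space.p y)
    exact ⟨_, Space.isProperMap_p.isCompact_preimage hC,
      Space.continuous_p.continuousAt.preimage_mem_nhds hyC⟩⟩
  infer_instance

/-- Continuity of the evaluation of kernels at pairs of arrows. -/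
theorem Space.continuous_eval {Z : Type*} [TopologicalSpace Z] {f : Z → κ.Space}
    {g : Z → RangePairs G} (hf : Continuous f) (hg : Continuous g)
    (h : ∀ z, pairRange (g z) = (f z).p) (j : J) : Continuous fun z => val (f z).1 j (g z) := by
  have h1 : Continuous fun z => ((f z).1, g z) := (continuous_subtype_val.comp hf).prodMk hg
  exact (continuousOn_eval isLocalHomeomorph_pairRange j).comp_continuous h1 h

theorem continuous_translatePair {Z : Type*} [TopologicalSpace Z] {f : Z → G}
    {g : Z → RangePairs G} (hf : Continuous f) (hg : Continuous g)
    (h : ∀ z, r (f z) = pairRange (g z)) : Continuous fun z => translatePair (f z) (g z) (h z) := by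
  refine Continuous.subtype_mk (Continuous.prodMk ?_ ?_) _
  · exact continuous_invMul.comp ((hf.prodMk (continuous_subtype_val.fst.comp hg)).subtype_mk _)
  · exact continuous_invMul.comp ((hf.prodMk (continuous_subtype_val.snd.comp hg)).subtype_mk _)

/-- The section of `Space` given by the kernels of `κ`. -/
noncomputable def unitSection (κ : KernelFamily G J) (x : units (G := G)) : κ.Space :=
  ⟨restrictMap κ x, admissible_restrictMap x⟩

theorem continuous_unitSection : Continuous (unitSection κ) := by
  refine Continuous.subtype_mk (continuous_of isLocalHomeomorph_pairRange continuous_id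
    fun j => ?_) _
  refine ((κ.continuous_k j).comp continuous_snd).continuousOn.congr fun z hz => ?_
  exact val_restrictMap j hz

/-- The action of `G` on the space of kernels, by translation. -/
noncomputable def gSpace (κ : KernelFamily G J) : GSpace G κ.Space where
  locallyCompactSpace := Space.locallyCompactSpace
  t2Space := Space.t2Space
  p := Space.p
  continuous_p := Space.continuous_p
  surjective_p x := ⟨unitSection κ x, rfl⟩
  act a y h := ⟨translateMap a y.1, y.2.translateMap h⟩
  continuous_act := by
    refine Continuous.subtype_mk (continuous_of isLocalHomeomorph_pairRange
      (continuous_r.comp continuous_subtype_val.fst) fun j => ?_) _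
    rw [continuousOn_iff_continuous_domRestrict]
    -- `z = (((a, y), s a = p y), e)` with `r a` the common range of the pair `e`
    have key := fun z : {z : {q : G × κ.Space // s q.1 = Space.p q.2} × RangePairs G //
        pairRange z.2 = r z.1.1.1} => val_translateMap z.1.1.1.1 z.1.1.1.2.1 j z.2.symm
    refine Continuous.congr ?_ fun z => (key z).symm
    exact Space.continuous_eval (continuous_subtype_val.snd.comp continuous_subtype_val.fst)
      (continuous_translatePair (continuous_subtype_val.fst.comp continuous_subtype_val.fst)
        continuous_subtype_val.snd fun z => z.2.symm)
      (fun z => (pairRange_translatePair _ _ z.2.symm).trans z.1.1.2) j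
  p_act _ _ _ := rfl
  unit_act y := by
    refine Subtype.ext (ext_of (r_unit _) fun j e he => ?_)
    have he : r (Space.p y : G) = pairRange e := Eq.symm he
    refine (val_translateMap _ _ j he).trans ?_
    congr 1
    refine Subtype.ext ((translatePair_val _ e he).trans (Prod.ext ?_ ?_))
    · exact ldiv_unit_left (he.symm.trans (r_unit _))
    · exact ldiv_unit_left (e.2.symm.trans (he.symm.trans (r_unit _)))
  mul_act a b y hab hb := by
    refine Subtype.ext (ext_of (r_mul _ _ _) fun j e he => ?_)
    have he : r (mul a b hab) = pairRange e := Eq.symm he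
    have ha : r a = pairRange e := (r_mul _ _ _).symm.trans he
    have hb' : r b = pairRange (translatePair a e ha) :=
      hab.symm.trans (pairRange_translatePair a e ha).symm
    refine (val_translateMap _ _ j he).trans
      (Eq.trans ?_ ((val_translateMap a _ j ha).trans (val_translateMap b _ j hb')).symm)
    congr 1
    refine Subtype.ext ?_
    rw [translatePair_val, translatePair_val, translatePair_val]
    exact Prod.ext (ldiv_mul hab ha) (ldiv_mul hab (ha.trans e.2))

/-- The function on `Y ⋊ G` given by the kernels with index `j`: at `(y, a)` it is the value of `y`
at the pair of `a` and the unit `r a`. -/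
noncomputable def evalFun (κ : KernelFamily G J) (j : J) (q : SemidirectProduct κ.gSpace) : ℂ :=
  val q.1.1.1 j ⟨(r q.1.2, q.1.2), r_unit _⟩

theorem continuous_evalFun (j : J) : Continuous (evalFun κ j) := by
  refine Space.continuous_eval SemidirectProduct.continuous_fst (Continuous.subtype_mk ?_ _)
    (fun q => (r_unit _).trans q.2.symm) j
  exact (continuous_subtype_val.comp (continuous_r.comp SemidirectProduct.continuous_snd)).prodMk
    SemidirectProduct.continuous_snd

theorem hasCompactSupport_evalFun (j : J) : HasCompactSupport (evalFun κ j) := by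
  refine HasCompactSupport.intro
    (SemidirectProduct.isCompact_setOf_snd_mem Space.isProperMap_p (κ.isCompact_D j)) fun q hq => ?_
  refine q.1.1.2.eq_zero j _ ?_
  rw [invMul_unit_left]; exact hq

theorem norm_evalFun_sub_one_le {j : J} {q : SemidirectProduct κ.gSpace} (hq : q.1.2 ∈ κ.U j) :
    ‖evalFun κ j q - 1‖ ≤ κ.δ j := by
  refine q.1.1.2.norm_sub_one_le j _ ((r_unit _).trans q.2.symm) ?_
  rw [invMul_unit_left]; exact hq

/-- On the range fibre of `Y ⋊ G` over `y`, the kernel defined by `evalFun κ j` is the kernel of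
index `j` of `y` itself. -/
theorem evalFun_invMul (j : J) (y : κ.Space) (a b : G) (ha : κ.gSpace.p y = r a)
    (hb : κ.gSpace.p y = r b) :
    evalFun κ j (invMul (⟨(⟨(y, a), ha⟩, ⟨(y, b), hb⟩), rfl⟩ :
      RangePairs (SemidirectProduct κ.gSpace))) = val y.1 j ⟨(a, b), ha.symm.trans hb⟩ := by
  have hab : r a = r b := ha.symm.trans hb
  have h1 : r (inv a) = r (invMul ⟨(a, b), hab⟩) := by rw [← ldiv_eq hab, r_ldiv hab, r_inv]
  have h2 : r (inv a) = pairRange (⟨(r (invMul ⟨(a, b), hab⟩), invMul ⟨(a, b), hab⟩), r_unit _⟩ :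
      RangePairs G) := h1.trans (r_unit _).symm
  refine (val_translateMap (inv a) y.1 j h2).trans ?_
  congr 1
  refine Subtype.ext ((translatePair_val _ _ h2).trans (Prod.ext ?_ ?_))
  · change ldiv (inv a) (r (invMul ⟨(a, b), hab⟩) : G) = a
    rw [ldiv_unit_right h1, inv_inv']
  · change ldiv (inv a) (invMul ⟨(a, b), hab⟩) = b
    rw [← ldiv_eq hab, ldiv_inv_ldiv hab]

theorem isPositiveDefiniteKernel_evalFun (j : J) :
    IsPositiveDefiniteKernel fun q => evalFun κ j (invMul q) := by
  rintro ⟨_, y, rfl⟩ n b c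
  have hy : ∀ i, (b i).1.1.1 = y := fun i =>
    SemidirectProduct.unit_injective κ.gSpace (congrArg Subtype.val (b i).2)
  have hp : ∀ i, κ.gSpace.p y = r (b i).1.1.2 := fun i =>
    (congrArg κ.gSpace.p (hy i)).symm.trans (b i).1.2
  refine (y.2.posDef j (κ.gSpace.p y) n (fun i => ⟨(b i).1.1.2, (hp i).symm⟩) c).trans_eq ?_
  refine Finset.sum_congr rfl fun i _ => Finset.sum_congr rfl fun m _ => ?_
  rw [← evalFun_invMul j y _ _ (hp i) (hp m)]
  congr 3
  exact Subtype.ext (Prod.ext (SemidirectProduct.ext_iff' (hy i).symm rfl)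
    (SemidirectProduct.ext_iff' (hy m).symm rfl))

end Topology

end KernelFamily

/-- The space of kernels built from approximating kernels is an amenable `G`-space. -/
theorem isStronglyAmenableAtInfinity_of_exists_net {G : Type u} [TopologicalSpace G]
    [GroupoidStr G] [IsEtaleGroupoid G] {I : Type u} [Preorder I] [IsDirectedOrder I] [Nonempty I]
    {k : I → RangePairs G → ℂ}
    (hk : ∀ i, Continuous (k i) ∧ (∃ C : ℝ, ∀ q, ‖k i q‖ ≤ C) ∧ IsPositiveDefiniteKernel (k i) ∧
        ∃ T : Set (RangePairs G), IsTube T ∧ tsupport (k i) ⊆ T)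
    (hlim : ∀ T : Set (RangePairs G), IsTube T → TendstoUniformlyOn k (fun _ => 1) atTop T) :
    IsStronglyAmenableAtInfinity G := by
  -- pick for each compact set and precision one kernel of the net
  have hex : ∀ j : Compacts G × ℕ, ∃ i, ∀ e, invMul e ∈ j.1 →
      ‖k i e - 1‖ ≤ 1 / ((j.2 : ℝ) + 1) := fun j => by
    obtain ⟨i, hi⟩ := (Metric.tendstoUniformlyOn_iff.1
      (hlim _ (isTube_preimage j.1.isCompact)) (1 / ((j.2 : ℝ) + 1)) (by positivity)).exists
    refine ⟨i, fun e he => ?_⟩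
    rw [← dist_eq_norm, dist_comm]
    exact (hi e he).le
  choose i hi using hex
  choose C hC using fun j => (hk (i j)).2.1
  choose T hT hsupp using fun j => (hk (i j)).2.2.2
  choose D hD hTD using fun j => (hT j).exists_isCompact
  let κ : KernelFamily G (Compacts G × ℕ) :=
    { k := fun j => k (i j)
      C := fun j => max (C j) 0
      D := D
      U := fun j => interior j.1
      δ := fun j => 1 / ((j.2 : ℝ) + 1)
      continuous_k := fun j => (hk (i j)).1
      C_nonneg := fun j => le_max_right _ _
      isCompact_D := hD
      isOpen_U := fun j => isOpen_interior
      norm_le := fun j e => (hC j e).trans (le_max_left _ _)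
      eq_zero := fun j e he => image_eq_zero_of_notMem_tsupport fun h => he (hTD j e (hsupp j h))
      norm_sub_one_le := fun j e he => hi j e (interior_subset he)
      posDef := fun j => (hk (i j)).2.2.1 }
  refine ⟨κ.Space, inferInstance, κ.gSpace, ?_, KernelFamily.Space.isProperMap_p,
    KernelFamily.unitSection κ, KernelFamily.continuous_unitSection, fun x => rfl⟩
  refine isAmenable_of_exists_positive_type fun K hK ε hε => ?_
  -- the estimates hold on the interior of the compact set, so `K` is enlarged first
  obtain ⟨L, hL, hKL⟩ := exists_compact_superset (hK.image SemidirectProduct.continuous_snd)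
  obtain ⟨n, hn⟩ := exists_nat_one_div_lt hε
  refine ⟨KernelFamily.evalFun κ (⟨L, hL⟩, n), KernelFamily.continuous_evalFun _,
    KernelFamily.hasCompactSupport_evalFun _, KernelFamily.isPositiveDefiniteKernel_evalFun _,
    fun q hq => (KernelFamily.norm_evalFun_sub_one_le (hKL ⟨q, hq, rfl⟩)).trans hn.le⟩

end TopGpd

theorem mainTheorem4 (G : Type u) [TopologicalSpace G] [TopGpd.GroupoidStr G]
    [TopGpd.IsEtaleGroupoid G] :
    TopGpd.IsStronglyAmenableAtInfinity G ↔
      ∃ (I : Type u) (_ : Preorder I) (_ : IsDirectedOrder I) (_ : Nonempty I)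
        (k : I → TopGpd.RangePairs G → ℂ),
        (∀ i, Continuous (k i) ∧ (∃ C : ℝ, ∀ q, ‖k i q‖ ≤ C) ∧
          TopGpd.IsPositiveDefiniteKernel (k i) ∧
          ∃ T : Set (TopGpd.RangePairs G), TopGpd.IsTube T ∧ tsupport (k i) ⊆ T) ∧
        ∀ T : Set (TopGpd.RangePairs G), TopGpd.IsTube T →
          TendstoUniformlyOn k (fun _ => 1) atTop T := by
  refine ⟨fun hG => hG.exists_net, ?_⟩
  rintro ⟨I, _, _, _, k, hk, hlim⟩
  exact TopGpd.isStronglyAmenableAtInfinity_of_exists_net hk hlim
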